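/- Let $(\Omega,\mu)$ be an arbitrary measure space, and let $A$ be a positive self-adjoint operator in $L^2(\Omega,\mu)$ (complex-valued functions) such that the $C_0$-semigroup $(T(t))_{t\ge 0}$ on $L^2(\Omega,\mu)$ generated by $-A$ satisfies $\|T(t)f\|_\infty\le\|f\|_\infty$ for all $t\ge0$ and all $f\in L^2(\Omega,\mu)\cap L^\infty(\Omega,\mu)$ (a symmetric $L^\infty$-contractive semigroup; positivity preservation is not assumed). Let $1<p<\infty$. Then there is exactly one family $(T_p(t))_{t\ge0}$ of bounded operators on $L^p(\Omega,\mu)$ with $T_p(t)f=T(t)f$ for all $t\ge 0$ and $f\in L^2(\Omega,\mu)\cap L^p(\Omega,\mu)$, and it is a $C_0$-semigroup of contractions. Let $-A_p$ be its generator. Put $F_p(z)=z|z|^{p-2}$ for $z\in\mathbb C\setminus\{0\}$ and $F_p(0)=0$, and for $0\le\varphi\le\pi/2$ let $\Sigma(\varphi)=\{z\in\mathbb C\setminus\{0\}:|\arg z|\le\varphi\}\cup\{0\}$. (a) The numerical range of $A_p$ is contained in the sector $\Sigma(\arcsin|1-2/p|)$, that is, $$\int_\Omega A_pf\cdot\overline{F_p(f)}\,d\mu\in\Sigma\bigl(\arcsin|1-\tfrac2p|\bigr)\qquad\text{for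 all } f\in\operatorname{dom}(A_p)\text{ with }\|f\|_p=1 .$$ (b) $(T_p(t))_{t\ge0}$ extends to an analytic contraction semigroup on the sector $\Sigma(\theta)$, $\theta=\arccos|1-2/p|$: there are bounded operators $S(z)$ on $L^p(\Omega,\mu)$, $z\in\Sigma(\theta)$, with $S(t)=T_p(t)$ for $t\ge0$, $S(z+w)=S(z)S(w)$ and $\|S(z)\|\le1$ for $z,w\in\Sigma(\theta)$, such that $z\mapsto S(z)f$ is continuous on $\Sigma(\theta)$ for every $f\in L^p(\Omega,\mu)$ and $z\mapsto S(z)$ is holomorphic in operator norm on the open sector $\{z\ne0:|\arg z|<\theta\}$. -/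

import Mathlib

open MeasureTheory Filter Topology
open scoped NNReal ENNReal ComplexConjugate

noncomputable section

/-- The map `z ↦ z |z|^(p-2)` on `ℂ`, with value `0` at `0`. -/
def dualityMap (p : ℝ) (z : ℂ) : ℂ :=
  if z = 0 then 0 else z * ((‖z‖ ^ (p - 2) : ℝ) : ℂ)

/-- The closed sector `{z ≠ 0 : |arg z| ≤ φ} ∪ {0}`. -/
def closedSector (φ : ℝ) : Set ℂ := {z | z ≠ 0 ∧ |z.arg| ≤ φ} ∪ {0}

/-- The open sector `{z ≠ 0 : |arg z| < φ}`. -/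
def openSector (φ : ℝ) : Set ℂ := {z | z ≠ 0 ∧ |z.arg| < φ}

section Semigroup

variable {E : Type*} [NormedAddCommGroup E] [NormedSpace ℂ E]

/-- `T` is a strongly continuous one-parameter semigroup of bounded operators. -/
structure IsC0Semigroup (T : ℝ≥0 → E →L[ℂ] E) : Prop where
  zero : T 0 = 1
  add : ∀ s t, T (s + t) = T s * T t
  continuous : ∀ f, Continuous fun t => T t f

/-- The generator of `T`: its domain is the set of all `f` for which `(T t f - f) / t` converges
in norm as `t ↓ 0`, and its value at such an `f` is the limit. -/
def generator (T : ℝ≥0 → E →L[ℂ] E) : E →ₗ.[ℂ] E where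
  domain :=
    { carrier := {f | ∃ g, Tendsto (fun t : ℝ≥0 => ((t : ℝ) : ℂ)⁻¹ • (T t f - f)) (𝓝[>] 0) (𝓝 g)}
      zero_mem' := ⟨0, by simp⟩
      add_mem' := by
        rintro f₁ f₂ ⟨g₁, h₁⟩ ⟨g₂, h₂⟩
        refine ⟨g₁ + g₂, (h₁.add h₂).congr fun t => ?_⟩
        rw [map_add, ← smul_add]
        congr 1
        abel
      smul_mem' := by
        rintro c f ⟨g, h⟩
        refine ⟨c • g, (h.const_smul c).congr fun t => ?_⟩
        rw [map_smul, ← smul_sub, smul_comm] }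
  toFun :=
    { toFun := fun f => f.2.choose
      map_add' := by
        intro f₁ f₂
        refine tendsto_nhds_unique (f₁ + f₂).2.choose_spec
          ((f₁.2.choose_spec.add f₂.2.choose_spec).congr fun t => ?_)
        rw [Submodule.coe_add, map_add, ← smul_add]
        congr 1
        abel
      map_smul' := by
        intro c f
        refine tendsto_nhds_unique (c • f).2.choose_spec
          ((f.2.choose_spec.const_smul c).congr fun t => ?_)
        rw [Submodule.coe_smul, map_smul, ← smul_sub, smul_comm] }

/-- `S`, restricted to the closed sector of opening angle `φ`, is an analytic contraction
semigroup: a semigroup of contractions that is strongly continuous on the closed sector and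
holomorphic in operator norm on the open sector. -/
structure IsAnalyticContractionSemigroup (φ : ℝ) (S : ℂ → E →L[ℂ] E) : Prop where
  zero : S 0 = 1
  add : ∀ z ∈ closedSector φ, ∀ w ∈ closedSector φ, S (z + w) = S z * S w
  contraction : ∀ z ∈ closedSector φ, ‖S z‖ ≤ 1
  continuousOn : ∀ f, ContinuousOn (fun z => S z f) (closedSector φ)
  analytic : DifferentiableOn ℂ S (openSector φ)

end Semigroup

section Lp

variable {Ω : Type*} [MeasurableSpace Ω] {μ : Measure Ω}

/-- `A` is a positive self-adjoint operator in `L²`, and `-A` generates the strongly continuous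
semigroup `T`, which is contractive for the `L^∞` norm on `L² ∩ L^∞`. -/
structure IsSymmetricLinftyContractive (A : Lp ℂ 2 μ →ₗ.[ℂ] Lp ℂ 2 μ)
    (T : ℝ≥0 → Lp ℂ 2 μ →L[ℂ] Lp ℂ 2 μ) : Prop where
  selfAdjoint : IsSelfAdjoint A
  nonneg : ∀ f : A.domain, 0 ≤ (inner ℂ (f : Lp ℂ 2 μ) (A f)).re
  semigroup : IsC0Semigroup T
  generator_eq : generator T = -A
  contractive : ∀ (t : ℝ≥0) (f : Lp ℂ 2 μ), MemLp f ∞ μ →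
    eLpNorm (T t f) ∞ μ ≤ eLpNorm f ∞ μ

/-- `Tp` is the `L^p`-realisation of `T`: a family of bounded operators on `L^p` which agrees
with `T` on `L² ∩ L^p`. -/
def IsLpRealisation {p : ℝ≥0∞} [Fact (1 ≤ p)] (T : ℝ≥0 → Lp ℂ 2 μ →L[ℂ] Lp ℂ 2 μ)
    (Tp : ℝ≥0 → Lp ℂ p μ →L[ℂ] Lp ℂ p μ) : Prop :=
  ∀ (t : ℝ≥0) (f : Lp ℂ 2 μ) (g : Lp ℂ p μ), f =ᵐ[μ] g → T t f =ᵐ[μ] Tp t g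

/-- The numerical range of an operator `B` in `L^p`. -/
def numericalRange {p : ℝ≥0∞} [Fact (1 ≤ p)] (B : Lp ℂ p μ →ₗ.[ℂ] Lp ℂ p μ) : Set ℂ :=
  {z | ∃ f : B.domain, ‖(f : Lp ℂ p μ)‖ = 1 ∧
    z = ∫ ω, B f ω * conj (dualityMap p.toReal ((f : Lp ℂ p μ) ω)) ∂μ}

end Lp

end

/-!
# Symmetric `L^∞`-contractive semigroups on `L^p`

Write `F_p z = z |z| ^ (p - 2)`. The pointwise reason for the theorem is the Liskevich–Perelmuter
inequality `sub_mul_conj_dualityMap_sub_mem`: for complex `z`, `w` the number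
`(z - w) conj (F_p z - F_p w)` lies in the sector of half-angle `arcsin |1 - 2 / p|`. It holds
because the sector is a closed convex cone containing `h conj (DF_p(u) h)` for all `u ≠ 0` and all `h`.

It is transferred to operators through matrices. Dissipativity and symmetry of the generator make
each `T t` a symmetric contraction on `L²`. For disjoint sets `A i` of finite measure put
`τ j i = ⟪1_{A j}, T 1_{A i}⟫`. This matrix is Hermitian, and `L^∞`-contractivity, tested on step
functions with suitable phases, gives `∑ i, |τ j i| ≤ μ (A j)`
(`IsSymmetricContraction.sum_norm_matrixEntry_le`). No positivity of `T` enters. Two facts follow.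

* Young's inequality applied entrywise bounds `|⟪g, T f⟫|` by `‖f‖ᵣʳ / r + ‖g‖ₛˢ / s` for
  conjugate exponents, and testing against truncations of `F_r (T f)` shows that `T` is a
  contraction for every `L^r` norm, `1 < r < ∞` (`IsSymmetricContraction.eLpNorm_apply_le`). No
  interpolation theorem is needed. The realisation on `L^p` is the extension by density. Its
  strong continuity is that on `L²` together with boundedness in `L^ρ` for an exponent `ρ` on the
  other side of `p`.
* The form `∫ (f - T f) conj (F_p f)` on step functions is a combination with nonnegative
  coefficients of numbers `|c i| ^ p` and of values of the pointwise expression above, so it lies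
  in the sector (`IsSymmetricContraction.inner_dualityMap_stepLp_mem`). By density this holds on
  all of `L^p` (`dualityFunctional_sub_apply_mem`); dividing by `t` and letting `t` tend to `0`
  yields the statement on the numerical range.

For the analytic extension, let `z` lie in the polar sector, of half-angle `arccos |1 - 2 / p|`.
Then `z (1 - T_p t)` is accretive, so its negative generates contractions
(`norm_exp_neg_smul_one_sub_le`). With `B_n = (n + 1) (1 - T_p (1 / (n + 1)))` the estimate
`‖exp (-z B_n) f - exp (-z B_m) f‖ ≤ |z| ‖B_n f - B_m f‖` shows that `exp (-z B_n)` converges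
strongly, locally uniformly on the closed sector; the limit is the extension
(`IsC0Semigroup.exists_analytic_extension`). Thus neither a functional calculus nor a generation
theorem is used.
-/

/-! ### Sectors -/

theorem mem_closedSector_iff {φ : ℝ} (h₀ : 0 ≤ φ) (h₁ : φ ≤ Real.pi / 2) (z : ℂ) :
    z ∈ closedSector φ ↔ 0 ≤ z.re ∧ |z.im| * Real.cos φ ≤ z.re * Real.sin φ := by
  by_cases hz : z = 0
  · simp [closedSector, hz]
  have hn : 0 < ‖z‖ := norm_pos_iff.2 hz
  have him : |z.im| = ‖z‖ * Real.sin |z.arg| := by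
    rw [← Complex.norm_mul_sin_arg z, abs_mul, abs_of_pos hn,
      Real.abs_sin_eq_sin_abs_of_abs_le_pi (Complex.abs_arg_le_pi z)]
  have hre : z.re = ‖z‖ * Real.cos |z.arg| := by
    rw [Real.cos_abs, Complex.norm_mul_cos_arg]
  have hmem : z ∈ closedSector φ ↔ |z.arg| ≤ φ := by simp [closedSector, hz]
  have hdiff : z.re * Real.sin φ - |z.im| * Real.cos φ = ‖z‖ * Real.sin (φ - |z.arg|) := by
    rw [him, hre, Real.sin_sub]; ring
  rw [hmem]
  constructor
  · intro h
    refine ⟨?_, sub_nonneg.1 ?_⟩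
    · exact Complex.abs_arg_le_pi_div_two_iff.1 (h.trans h₁)
    · rw [hdiff]
      exact mul_nonneg hn.le (Real.sin_nonneg_of_nonneg_of_le_pi (by linarith)
        (by linarith [abs_nonneg z.arg, Real.pi_pos]))
  · rintro ⟨h, h'⟩
    have ha := Complex.abs_arg_le_pi_div_two_iff.2 h
    by_contra! hlt
    have := Real.sin_neg_of_neg_of_neg_pi_lt (x := φ - |z.arg|) (by linarith)
      (by linarith [Real.pi_pos])
    nlinarith [sub_nonneg.2 h']

theorem isClosed_closedSector {φ : ℝ} (h₀ : 0 ≤ φ) (h₁ : φ ≤ Real.pi / 2) :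
    IsClosed (closedSector φ) := by
  have : closedSector φ =
      {z | 0 ≤ z.re} ∩ {z | |z.im| * Real.cos φ ≤ z.re * Real.sin φ} := by
    ext z; exact mem_closedSector_iff h₀ h₁ z
  rw [this]
  exact (isClosed_le (by fun_prop) (by fun_prop)).inter (isClosed_le (by fun_prop) (by fun_prop))

theorem zero_mem_closedSector (φ : ℝ) : (0 : ℂ) ∈ closedSector φ := by simp [closedSector]

theorem add_mem_closedSector {φ : ℝ} (h₀ : 0 ≤ φ) (h₁ : φ ≤ Real.pi / 2) {z w : ℂ}
    (hz : z ∈ closedSector φ) (hw : w ∈ closedSector φ) : z + w ∈ closedSector φ := by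
  rw [mem_closedSector_iff h₀ h₁] at *
  have hc := Real.cos_nonneg_of_neg_pi_div_two_le_of_le (by linarith [Real.pi_pos]) h₁
  refine ⟨by simpa using add_nonneg hz.1 hw.1, ?_⟩
  calc |(z + w).im| * Real.cos φ ≤ (|z.im| + |w.im|) * Real.cos φ := by
        gcongr; simpa using abs_add_le z.im w.im
    _ ≤ (z + w).re * Real.sin φ := by simp only [Complex.add_re]; linarith [hz.2, hw.2]

theorem smul_mem_closedSector {φ : ℝ} (h₀ : 0 ≤ φ) (h₁ : φ ≤ Real.pi / 2) {z : ℂ}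
    (hz : z ∈ closedSector φ) {r : ℝ} (hr : 0 ≤ r) : (r : ℂ) * z ∈ closedSector φ := by
  rw [mem_closedSector_iff h₀ h₁] at *
  have h1 : ((r : ℂ) * z).re = r * z.re := by simp
  have h2 : ((r : ℂ) * z).im = r * z.im := by simp
  rw [h1, h2, abs_mul, abs_of_nonneg hr]
  exact ⟨mul_nonneg hr hz.1, by nlinarith [hz.2]⟩

theorem sum_mem_closedSector {φ : ℝ} (h₀ : 0 ≤ φ) (h₁ : φ ≤ Real.pi / 2) {ι : Type*}
    (s : Finset ι) {f : ι → ℂ} (hf : ∀ i ∈ s, f i ∈ closedSector φ) :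
    ∑ i ∈ s, f i ∈ closedSector φ :=
  Finset.sum_induction f (· ∈ closedSector φ) (fun _ _ => add_mem_closedSector h₀ h₁)
    (zero_mem_closedSector φ) hf

theorem ofReal_mem_closedSector {φ : ℝ} (h₀ : 0 ≤ φ) (h₁ : φ ≤ Real.pi / 2) {r : ℝ}
    (hr : 0 ≤ r) : (r : ℂ) ∈ closedSector φ := by
  rw [mem_closedSector_iff h₀ h₁]
  simpa [hr] using mul_nonneg hr (Real.sin_nonneg_of_nonneg_of_le_pi h₀
    (by linarith [Real.pi_pos]))

theorem isOpen_openSector {φ : ℝ} (h : φ ≤ Real.pi / 2) : IsOpen (openSector φ) := by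
  have : openSector φ = Complex.slitPlane ∩ {z | |z.arg| < φ} := by
    ext z
    simp only [openSector, Set.mem_inter_iff, Set.mem_ofPred_eq, Complex.mem_slitPlane_iff_arg]
    refine ⟨fun ⟨h1, h2⟩ => ⟨⟨fun h3 => ?_, h1⟩, h2⟩, fun ⟨h1, h2⟩ => ⟨h1.2, h2⟩⟩
    rw [h3, abs_of_pos Real.pi_pos] at h2
    linarith [Real.pi_pos]
  rw [this]
  refine ContinuousOn.isOpen_inter_preimage (t := Set.Iio φ)
    (f := fun z : ℂ => |z.arg|) ?_ Complex.isOpen_slitPlane isOpen_Iio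
  exact fun z hz => (Complex.continuousAt_arg hz).abs.continuousWithinAt

theorem openSector_subset_closedSector (φ : ℝ) : openSector φ ⊆ closedSector φ :=
  fun _ hz => Or.inl ⟨hz.1, hz.2.le⟩

/-- The sectors of half-angles `arccos c` and `arcsin c` are polar to each other. -/
theorem re_mul_nonneg_of_mem_closedSector {c : ℝ} (h₀ : 0 ≤ c) (h₁ : c < 1) {z w : ℂ}
    (hz : z ∈ closedSector (Real.arccos c)) (hw : w ∈ closedSector (Real.arcsin c)) :
    0 ≤ (z * w).re := by
  rw [mem_closedSector_iff (Real.arccos_nonneg _) (Real.arccos_le_pi_div_two.2 h₀),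
    Real.cos_arccos (by linarith) h₁.le, Real.sin_arccos] at hz
  rw [mem_closedSector_iff (Real.arcsin_nonneg.2 h₀) (Real.arcsin_le_pi_div_two _),
    Real.cos_arcsin, Real.sin_arcsin (by linarith) h₁.le] at hw
  have hs : 0 < √(1 - c ^ 2) := Real.sqrt_pos.2 (by nlinarith)
  set s := √(1 - c ^ 2)
  have key : |z.im| * |w.im| ≤ z.re * w.re := by
    rcases h₀.eq_or_lt with rfl | hc
    · have : |w.im| = 0 := by nlinarith [abs_nonneg w.im, hw.2]
      rw [this, mul_zero]
      exact mul_nonneg hz.1 hw.1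
    · have := mul_le_mul hz.2 hw.2 (by positivity) (mul_nonneg hz.1 hs.le)
      have hcs : 0 < c * s := by positivity
      nlinarith
  have := le_abs_self (z.im * w.im)
  rw [abs_mul] at this
  rw [Complex.mul_re]
  linarith

/-! ### The duality map -/

theorem dualityMap_eq_smul (p : ℝ) (z : ℂ) : dualityMap p z = (‖z‖ ^ (p - 2)) • z := by
  by_cases hz : z = 0
  · simp [dualityMap, hz]
  · simp [dualityMap, hz, mul_comm]

@[simp] theorem dualityMap_zero (p : ℝ) : dualityMap p 0 = 0 := by simp [dualityMap]

theorem norm_dualityMap {p : ℝ} (hp : 1 < p) (z : ℂ) : ‖dualityMap p z‖ = ‖z‖ ^ (p - 1) := by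
  rcases eq_or_ne z 0 with rfl | hz
  · rw [dualityMap_zero, norm_zero, Real.zero_rpow (by linarith)]
  · have hn : 0 < ‖z‖ := norm_pos_iff.2 hz
    rw [dualityMap_eq_smul, norm_smul, Real.norm_of_nonneg (by positivity),
      show p - 1 = p - 2 + 1 by ring, Real.rpow_add_one hn.ne']

theorem mul_conj_dualityMap {p : ℝ} (hp : 1 < p) (z : ℂ) :
    z * conj (dualityMap p z) = ((‖z‖ ^ p : ℝ) : ℂ) := by
  rcases eq_or_ne z 0 with rfl | hz
  · rw [zero_mul, norm_zero, Real.zero_rpow (by linarith), Complex.ofReal_zero]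
  · have hn : 0 < ‖z‖ := norm_pos_iff.2 hz
    rw [dualityMap_eq_smul, Complex.real_smul, map_mul, Complex.conj_ofReal, mul_left_comm,
      Complex.mul_conj', ← Complex.ofReal_pow, ← Complex.ofReal_mul]
    congr 1
    rw [← Real.rpow_natCast, ← Real.rpow_add hn]
    congr 1
    push_cast
    ring

theorem dualityMap_mul_of_norm_eq_one (p : ℝ) {c : ℂ} (hc : ‖c‖ = 1) (z : ℂ) :
    dualityMap p (c * z) = c * dualityMap p z := by
  simp only [dualityMap_eq_smul, norm_mul, hc, one_mul, Complex.real_smul]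
  ring

theorem dualityMap_ofReal_mul {p : ℝ} (hp : 1 < p) {r : ℝ} (hr : 0 ≤ r) (z : ℂ) :
    dualityMap p (r * z) = ((r ^ (p - 1) : ℝ) : ℂ) * dualityMap p z := by
  rcases hr.eq_or_lt with rfl | hr
  · simp [Real.zero_rpow (show p - 1 ≠ 0 by linarith)]
  simp only [dualityMap_eq_smul, norm_mul, Complex.real_smul, Complex.norm_real,
    Real.norm_of_nonneg hr.le]
  rw [Real.mul_rpow hr.le (norm_nonneg _), show p - 1 = p - 2 + 1 by ring,
    Real.rpow_add_one hr.ne']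
  push_cast
  ring

theorem continuous_dualityMap {p : ℝ} (hp : 1 < p) : Continuous (dualityMap p) := by
  rw [continuous_iff_continuousAt]
  intro z
  rcases eq_or_ne z 0 with rfl | hz
  · rw [ContinuousAt, dualityMap_zero, tendsto_zero_iff_norm_tendsto_zero]
    simp only [norm_dualityMap hp]
    have : ContinuousAt (fun w : ℂ => ‖w‖ ^ (p - 1)) 0 :=
      continuous_norm.continuousAt.rpow_const (Or.inr (by linarith))
    simpa [ContinuousAt, Real.zero_rpow (show p - 1 ≠ 0 by linarith)] using this
  · have : dualityMap p = fun z => (‖z‖ ^ (p - 2)) • z := funext (dualityMap_eq_smul p)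
    rw [this]
    exact (continuous_norm.continuousAt.rpow_const (Or.inl (norm_ne_zero_iff.2 hz))).smul
      continuousAt_id

/-- If the quadratic form `α((p-1)a² + b²) + β(p-2)ab` is nonnegative, then the corresponding
functional is nonnegative on `(z - w) conj (F z - F w)`: away from the origin this is the
derivative of `F` along the segment from `w` to `z`. -/
theorem dualityMap_sub_functional_nonneg {p : ℝ} (hp : 1 < p) {α β : ℝ} (hα : 0 ≤ α)
    (h : ∀ a b : ℝ, 0 ≤ α * ((p - 1) * a ^ 2 + b ^ 2) + β * ((p - 2) * a * b)) (z w : ℂ) :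
    0 ≤ α * ((z - w) * conj (dualityMap p z - dualityMap p w)).re +
      β * ((z - w) * conj (dualityMap p z - dualityMap p w)).im := by
  set d := z - w with hd
  -- `F` need not be differentiable at the origin, so segments through it are treated by hand.
  by_cases h0 : ∃ r ∈ Set.Icc (0 : ℝ) 1, w + r * d = 0
  · obtain ⟨r, hr, hr0⟩ := h0
    have hw : w = (-1) * (r * d) := by linear_combination hr0
    have hz : z = ((1 - r : ℝ) : ℂ) * d := by push_cast; linear_combination hr0 + (-1 : ℂ) * hd
    have : d * conj (dualityMap p z - dualityMap p w) =
        (((1 - r) ^ (p - 1) + r ^ (p - 1)) * ‖d‖ ^ p : ℝ) := by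
      rw [hz, hw, dualityMap_mul_of_norm_eq_one p (c := -1) (by simp),
        dualityMap_ofReal_mul hp hr.1, dualityMap_ofReal_mul hp (by linarith [hr.2])]
      push_cast
      rw [← mul_conj_dualityMap hp]
      simp only [map_sub, map_mul, Complex.conj_ofReal, map_neg, map_one]
      ring
    rw [this, Complex.ofReal_re, Complex.ofReal_im, mul_zero, add_zero]
    have h1 : 0 ≤ 1 - r := by linarith [hr.2]
    have h2 := hr.1
    positivity
  push Not at h0
  set u : ℝ → ℂ := fun r => w + r * d with hu
  set ℓ : ℝ → ℝ := fun r => α * (d * conj (u r)).re + β * (d * conj (u r)).im with hℓ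
  set g : ℝ → ℝ := fun r => (‖u r‖ ^ 2) ^ ((p - 2) / 2) * ℓ r with hg
  have hF : ∀ r, g r = α * (d * conj (dualityMap p (u r))).re +
      β * (d * conj (dualityMap p (u r))).im := by
    intro r
    have e : (‖u r‖ ^ 2) ^ ((p - 2) / 2) = ‖u r‖ ^ (p - 2) := by
      rw [← Real.rpow_natCast, ← Real.rpow_mul (norm_nonneg _)]
      congr 1; push_cast; ring
    simp only [hg, hℓ, dualityMap_eq_smul, e, Complex.real_smul, map_mul, Complex.conj_ofReal]
    rw [mul_left_comm d, Complex.re_ofReal_mul, Complex.im_ofReal_mul]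
    ring
  have hud : ∀ r, HasDerivAt u d r := by
    intro r
    have := ((Complex.ofRealCLM.hasDerivAt (x := r)).mul_const d).const_add w
    simpa [hu] using this
  have hn : ∀ r, HasDerivAt (fun r => ‖u r‖ ^ 2) (2 * (d * conj (u r)).re) r := by
    intro r
    have := (hud r).norm_sq
    simpa [Complex.inner] using this
  have hℓd : ∀ r, HasDerivAt ℓ (α * ‖d‖ ^ 2) r := by
    intro r
    have h1 : HasDerivAt (fun r => d * conj (u r)) (d * conj d) r :=
      (Complex.conjCLE.toContinuousLinearMap.hasFDerivAt.comp_hasDerivAt r (hud r)).const_mul d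
    rw [Complex.mul_conj'] at h1
    have h2 := Complex.reCLM.hasFDerivAt.comp_hasDerivAt r h1
    have h3 := Complex.imCLM.hasFDerivAt.comp_hasDerivAt r h1
    have h4 := (h2.const_mul α).add (h3.const_mul β)
    refine h4.congr_deriv ?_
    simp [← Complex.ofReal_pow]
  have hgd : ∀ r ∈ Set.Icc (0 : ℝ) 1, ∃ g', 0 ≤ g' ∧ HasDerivAt g g' r := by
    intro r hr
    have hne : u r ≠ 0 := h0 r hr
    have hpos : 0 < ‖u r‖ ^ 2 := by positivity
    refine ⟨_, ?_, ((hn r).rpow_const (p := (p - 2) / 2) (Or.inl hpos.ne')).mul (hℓd r)⟩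
    set a := (d * conj (u r)).re
    set b := (d * conj (u r)).im
    have hab : ‖u r‖ ^ 2 * ‖d‖ ^ 2 = a ^ 2 + b ^ 2 := by
      have : ‖d * conj (u r)‖ ^ 2 = a ^ 2 + b ^ 2 := by
        rw [Complex.sq_norm, Complex.normSq_apply]; ring
      rw [← this, norm_mul, RCLike.norm_conj]; ring
    have e : (‖u r‖ ^ 2) ^ ((p - 2) / 2) = (‖u r‖ ^ 2) ^ ((p - 2) / 2 - 1) * ‖u r‖ ^ 2 := by
      rw [← Real.rpow_add_one hpos.ne', sub_add_cancel]
    have : 2 * a * ((p - 2) / 2) * (‖u r‖ ^ 2) ^ ((p - 2) / 2 - 1) * ℓ r +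
        (‖u r‖ ^ 2) ^ ((p - 2) / 2) * (α * ‖d‖ ^ 2) = (‖u r‖ ^ 2) ^ ((p - 2) / 2 - 1) *
          (α * ((p - 1) * a ^ 2 + b ^ 2) + β * ((p - 2) * a * b)) := by
      rw [e, show ℓ r = α * a + β * b from rfl]
      linear_combination α * (‖u r‖ ^ 2) ^ ((p - 2) / 2 - 1) * hab
    rw [this]
    exact mul_nonneg (by positivity) (h a b)
  have hmono : MonotoneOn g (Set.Icc 0 1) := by
    refine monotoneOn_of_deriv_nonneg (convex_Icc _ _) ?_ ?_ ?_
    · intro r hr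
      obtain ⟨g', -, h'⟩ := hgd r hr
      exact h'.continuousAt.continuousWithinAt
    · intro r hr
      obtain ⟨g', -, h'⟩ := hgd r (interior_subset hr)
      exact h'.differentiableAt.differentiableWithinAt
    · intro r hr
      obtain ⟨g', h1, h'⟩ := hgd r (interior_subset hr)
      rwa [h'.deriv]
  have hle := hmono (Set.left_mem_Icc.2 zero_le_one) (Set.right_mem_Icc.2 zero_le_one) zero_le_one
  rw [hF, hF] at hle
  have hu0 : u 0 = w := by simp [hu]
  have hu1 : u 1 = z := by simp [hu, hd]
  rw [hu0, hu1] at hle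
  rw [map_sub, mul_sub, Complex.sub_re, Complex.sub_im]
  linarith

theorem abs_one_sub_two_div_lt_one {p : ℝ} (hp : 1 < p) : |1 - 2 / p| < 1 := by
  have h2 : 2 / p < 2 := by rw [div_lt_iff₀ (by linarith)]; linarith
  have h0 : 0 < 2 / p := by positivity
  rw [abs_lt]
  constructor <;> linarith

/-- The Liskevich–Perelmuter inequality: `F_p` is sectorial on `ℂ`. -/
theorem sub_mul_conj_dualityMap_sub_mem {p : ℝ} (hp : 1 < p) (z w : ℂ) :
    (z - w) * conj (dualityMap p z - dualityMap p w) ∈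
      closedSector (Real.arcsin |1 - 2 / p|) := by
  have hc := abs_one_sub_two_div_lt_one hp
  have hp0 : 0 < p := by linarith
  rw [mem_closedSector_iff (Real.arcsin_nonneg.2 (abs_nonneg _)) (Real.arcsin_le_pi_div_two _),
    Real.cos_arcsin, Real.sin_arcsin (by linarith [abs_nonneg (1 - 2 / p)]) hc.le]
  set c := 1 - 2 / p with hcdef
  have hpc : p - 2 = p * c := by rw [hcdef]; field_simp
  have hs : √(1 - |c| ^ 2) ^ 2 = 1 - c ^ 2 := by
    rw [Real.sq_sqrt (by nlinarith [abs_nonneg c]), sq_abs]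
  set s := √(1 - |c| ^ 2)
  have hs0 : 0 ≤ s := Real.sqrt_nonneg _
  have hps : (p * s) ^ 2 = 4 * (p - 1) := by
    rw [mul_pow, hs, hcdef]; field_simp; ring
  constructor
  · have := dualityMap_sub_functional_nonneg hp (α := 1) (β := 0) zero_le_one
      (fun a b => by nlinarith [mul_nonneg (sub_nonneg.2 hp.le) (sq_nonneg a), sq_nonneg b]) z w
    simpa using this
  · have key : ∀ σ : ℝ, σ ^ 2 = 1 → ∀ a b : ℝ,
        0 ≤ |c| * ((p - 1) * a ^ 2 + b ^ 2) + σ * s * ((p - 2) * a * b) := by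
      intro σ hσ a b
      obtain ⟨τ, hτ, hτc⟩ : ∃ τ : ℝ, τ ^ 2 = 1 ∧ c = τ * |c| := by
        rcases le_total 0 c with h | h
        · exact ⟨1, by norm_num, by rw [abs_of_nonneg h]; ring⟩
        · exact ⟨-1, by norm_num, by rw [abs_of_nonpos h]; ring⟩
      have : |c| * ((p - 1) * a ^ 2 + b ^ 2) + σ * s * ((p - 2) * a * b) =
          |c| * (p * s / 2 * a + σ * τ * b) ^ 2 := by
        rw [hpc]
        nth_rewrite 2 [hτc]
        linear_combination (-|c| * a ^ 2 / 4) * hps - |c| * b ^ 2 * (τ ^ 2 * hσ + hτ)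
      rw [this]
      positivity
    have h1 := dualityMap_sub_functional_nonneg hp (abs_nonneg c) (key 1 (by norm_num)) z w
    have h2 := dualityMap_sub_functional_nonneg hp (abs_nonneg c) (key (-1) (by norm_num)) z w
    set X := (z - w) * conj (dualityMap p z - dualityMap p w)
    rcases abs_cases X.im with ⟨h, -⟩ | ⟨h, -⟩ <;> rw [h] <;> linarith

/-! ### Orbits of strongly continuous semigroups -/

section Semigroup

variable {E : Type*} [NormedAddCommGroup E] [NormedSpace ℂ E] {T : ℝ≥0 → E →L[ℂ] E}

/-- `(f, g)` belongs to the graph of the generator of `T`. -/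
def InGeneratorGraph (T : ℝ≥0 → E →L[ℂ] E) (f g : E) : Prop :=
  Tendsto (fun t : ℝ≥0 => ((t : ℝ) : ℂ)⁻¹ • (T t f - f)) (𝓝[>] 0) (𝓝 g)

theorem inGeneratorGraph_generator (f : (generator T).domain) :
    InGeneratorGraph T f (generator T f) := f.2.choose_spec

theorem InGeneratorGraph.mem_domain {f g : E} (h : InGeneratorGraph T f g) :
    f ∈ (generator T).domain := ⟨g, h⟩

theorem tendsto_toNNReal_nhdsGT_zero {α : Type*} {l : Filter α} {u : α → ℝ}
    (hu : Tendsto u l (𝓝[>] 0)) : Tendsto (fun a => (u a).toNNReal) l (𝓝[>] (0 : ℝ≥0)) := by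
  rw [tendsto_nhdsWithin_iff] at hu ⊢
  refine ⟨?_, hu.2.mono fun a ha => Real.toNNReal_pos.2 ha⟩
  have := (continuous_real_toNNReal.tendsto 0).comp hu.1
  rwa [Real.toNNReal_zero] at this

theorem InGeneratorGraph.tendsto_real {f g : E} (h : InGeneratorGraph T f g) {α : Type*}
    {l : Filter α} {u : α → ℝ} (hu : Tendsto u l (𝓝[>] 0)) :
    Tendsto (fun a => (u a)⁻¹ • (T (u a).toNNReal f - f)) l (𝓝 g) := by
  refine (h.comp (tendsto_toNNReal_nhdsGT_zero hu)).congr' ?_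
  filter_upwards [(tendsto_nhdsWithin_iff.1 hu).2] with a ha
  simp only [Function.comp, Real.coe_toNNReal _ (Set.mem_Ioi.1 ha).le]
  rw [← Complex.ofReal_inv, Complex.coe_smul]

namespace IsC0Semigroup

theorem apply_add (hT : IsC0Semigroup T) (s t : ℝ≥0) (f : E) : T (s + t) f = T s (T t f) := by
  rw [hT.add]; rfl

theorem commute (hT : IsC0Semigroup T) (s t : ℝ≥0) : Commute (T s) (T t) := by
  rw [Commute, SemiconjBy, ← hT.add, ← hT.add, add_comm]

theorem apply_comm (hT : IsC0Semigroup T) (s t : ℝ≥0) (f : E) : T s (T t f) = T t (T s f) := by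
  rw [← hT.apply_add, ← hT.apply_add, add_comm]

theorem continuous_orbit (hT : IsC0Semigroup T) (f : E) :
    Continuous fun r : ℝ => T r.toNNReal f :=
  (hT.continuous f).comp continuous_real_toNNReal

theorem inGeneratorGraph_apply (hT : IsC0Semigroup T) {f g : E} (h : InGeneratorGraph T f g)
    (t : ℝ≥0) : InGeneratorGraph T (T t f) (T t g) := by
  refine (((T t).continuous.tendsto g).comp h).congr fun s => ?_
  simp only [Function.comp, map_smul, map_sub]
  rw [hT.apply_comm t s]

theorem hasDerivWithinAt_orbit (hT : IsC0Semigroup T) {f g : E} (h : InGeneratorGraph T f g)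
    {t : ℝ} (ht : 0 ≤ t) :
    HasDerivWithinAt (fun r : ℝ => T r.toNNReal f) (T t.toNNReal g) (Set.Ici t) t := by
  rw [← hasDerivWithinAt_Ioi_iff_Ici, hasDerivWithinAt_iff_tendsto_slope' Set.self_notMem_Ioi]
  have hu : Tendsto (fun r : ℝ => r - t) (𝓝[>] t) (𝓝[>] 0) := by
    rw [tendsto_nhdsWithin_iff]
    refine ⟨?_, ?_⟩
    · have : Tendsto (fun r : ℝ => r - t) (𝓝 t) (𝓝 (t - t)) :=
          (by fun_prop : Continuous fun r : ℝ => r - t).tendsto t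
      rw [sub_self] at this
      exact this.mono_left nhdsWithin_le_nhds
    · filter_upwards [self_mem_nhdsWithin] with r hr using sub_pos.2 (Set.mem_Ioi.1 hr)
  refine (((T t.toNNReal).continuous.tendsto g).comp (h.tendsto_real hu)).congr' ?_
  filter_upwards [self_mem_nhdsWithin] with r hr
  have hr' : t ≤ r := (Set.mem_Ioi.1 hr).le
  have : r.toNNReal = t.toNNReal + (r - t).toNNReal := by
    rw [← Real.toNNReal_add ht (sub_nonneg.2 hr')]; simp
  rw [slope_def_module, this, hT.apply_add]
  simp [map_sub]

/-- Two-sided differentiability of orbits; contractivity is what controls the left difference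
quotients. -/
theorem hasDerivAt_orbit (hT : IsC0Semigroup T) (hc : ∀ t, ‖T t‖ ≤ 1) {f g : E}
    (h : InGeneratorGraph T f g) {t : ℝ} (ht : 0 < t) :
    HasDerivAt (fun r : ℝ => T r.toNNReal f) (T t.toNNReal g) t := by
  have hleft : HasDerivWithinAt (fun r : ℝ => T r.toNNReal f) (T t.toNNReal g) (Set.Iic t) t := by
    rw [← hasDerivWithinAt_Iio_iff_Iic, hasDerivWithinAt_iff_tendsto_slope' Set.self_notMem_Iio]
    have hu : Tendsto (fun r : ℝ => t - r) (𝓝[<] t) (𝓝[>] 0) := by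
      rw [tendsto_nhdsWithin_iff]
      refine ⟨?_, ?_⟩
      · have : Tendsto (fun r : ℝ => t - r) (𝓝 t) (𝓝 (t - t)) :=
          (by fun_prop : Continuous fun r : ℝ => t - r).tendsto t
        rw [sub_self] at this
        exact this.mono_left nhdsWithin_le_nhds
      · filter_upwards [self_mem_nhdsWithin] with r hr using sub_pos.2 (Set.mem_Iio.1 hr)
    have h1 : Tendsto (fun r : ℝ => T r.toNNReal
        ((t - r)⁻¹ • (T (t - r).toNNReal f - f) - g)) (𝓝[<] t) (𝓝 0) := by
      have h0 := (h.tendsto_real hu).sub_const g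
      rw [sub_self] at h0
      refine squeeze_zero_norm (fun r => ?_) (tendsto_zero_iff_norm_tendsto_zero.1 h0)
      exact ((T r.toNNReal).le_of_opNorm_le (hc _) _).trans_eq (one_mul _)
    have h2 : Tendsto (fun r : ℝ => T r.toNNReal g) (𝓝[<] t) (𝓝 (T t.toNNReal g)) :=
      ((hT.continuous_orbit g).tendsto t).mono_left nhdsWithin_le_nhds
    have h3 := h1.add h2
    rw [zero_add] at h3
    refine h3.congr' ?_
    have hpos : ∀ᶠ r in 𝓝[<] t, 0 < r := (eventually_gt_nhds ht).filter_mono nhdsWithin_le_nhds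
    filter_upwards [self_mem_nhdsWithin, hpos] with r hr hr0
    have hr' : r ≤ t := (Set.mem_Iio.1 hr).le
    have : t.toNNReal = r.toNNReal + (t - r).toNNReal := by
      rw [← Real.toNNReal_add hr0.le (sub_nonneg.2 hr')]; simp
    rw [slope_def_module, this, hT.apply_add, map_sub, sub_add_cancel, ← neg_sub t r, inv_neg,
      neg_smul, ← smul_neg, neg_sub]
    simp [map_sub]
  have := hleft.union (hT.hasDerivWithinAt_orbit h ht.le)
  rwa [Set.Iic_union_Ici, hasDerivWithinAt_univ] at this

/-- The averages of an orbit over `[0, h]` lie in the domain of the generator. -/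
theorem dense_domain_generator [CompleteSpace E] (hT : IsC0Semigroup T) :
    Dense ((generator T).domain : Set E) := by
  intro f
  set orb : ℝ → E := fun r => T r.toNNReal f with horb
  have hcont : Continuous orb := hT.continuous_orbit f
  set F : ℝ → E := fun x => ∫ r in (0 : ℝ)..x, orb r with hF
  have hFd : ∀ x, HasDerivAt F (orb x) x := fun x =>
    (hcont.integral_hasStrictDerivAt 0 x).hasDerivAt
  have hF0 : F 0 = 0 := by simp [hF]
  have horb0 : orb 0 = f := by simp [horb, hT.zero]
  have hmem : ∀ h : ℝ, 0 < h → F h ∈ (generator T).domain := by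
    intro h hh
    refine InGeneratorGraph.mem_domain (g := orb h - orb 0) ?_
    have key : ∀ t : ℝ≥0, T t (F h) - F h = (F (h + t) - F h) - (F (0 + t) - F 0) := by
      intro t
      have h1 : T t (F h) = ∫ r in (0 : ℝ)..h, orb (t + r) := by
        rw [hF, ← ContinuousLinearMap.intervalIntegral_comp_comm _
          (hcont.intervalIntegrable _ _)]
        refine intervalIntegral.integral_congr fun r hr => ?_
        rw [Set.uIcc_of_le hh.le] at hr
        change T t (T r.toNNReal f) = T ((t : ℝ) + r).toNNReal f
        rw [Real.toNNReal_add t.coe_nonneg hr.1, hT.apply_add, Real.toNNReal_coe]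
      rw [h1, intervalIntegral.integral_comp_add_left, hF0, zero_add, sub_zero, add_zero,
        ← intervalIntegral.integral_interval_sub_left (hcont.intervalIntegrable 0 _)
          (hcont.intervalIntegrable 0 _), add_comm (t : ℝ) h]
      simp only [hF]
      abel
    have hco : Tendsto (fun t : ℝ≥0 => (t : ℝ)) (𝓝[>] 0) (𝓝[>] 0) := by
      rw [tendsto_nhdsWithin_iff]
      refine ⟨?_, ?_⟩
      · exact (NNReal.continuous_coe.tendsto 0).mono_left nhdsWithin_le_nhds
      · filter_upwards [self_mem_nhdsWithin] with r hr using NNReal.coe_pos.2 hr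
    have h1 := ((hFd h).tendsto_slope_zero_right.comp hco).sub
      ((hFd 0).tendsto_slope_zero_right.comp hco)
    refine h1.congr fun t => ?_
    simp only [Function.comp]
    rw [key, ← smul_sub, ← Complex.ofReal_inv, Complex.coe_smul]
  have hlim : Tendsto (fun h : ℝ => h⁻¹ • F h) (𝓝[>] 0) (𝓝 f) := by
    have := (hFd 0).tendsto_slope_zero_right
    rw [horb0, hF0] at this
    simpa using this
  refine mem_closure_of_tendsto hlim ?_
  filter_upwards [self_mem_nhdsWithin] with h hh
  rw [← Complex.coe_smul]
  exact (generator T).domain.smul_mem _ (hmem h hh)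

end IsC0Semigroup

end Semigroup

section Hilbert

variable {H : Type*} [NormedAddCommGroup H] [InnerProductSpace ℂ H] {T : ℝ≥0 → H →L[ℂ] H}

namespace IsC0Semigroup

/-- `‖T t f‖ ^ 2` has nonpositive right derivative for `f` in the domain of the generator. -/
theorem norm_le_one_of_dissipative (hT : IsC0Semigroup T)
    (hd : Dense ((generator T).domain : Set H))
    (hdiss : ∀ f g, InGeneratorGraph T f g → (inner ℂ f g).re ≤ 0) (t : ℝ≥0) : ‖T t‖ ≤ 1 := by
  refine (T t).opNorm_le_bound zero_le_one fun f => ?_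
  rw [one_mul]
  let _ : InnerProductSpace ℝ H := InnerProductSpace.complexToReal
  refine hd.induction (P := fun f => ‖T t f‖ ≤ ‖f‖) ?_
    (isClosed_le (by fun_prop) (by fun_prop)) f
  rintro f ⟨g, hfg⟩
  have key := image_le_of_deriv_right_le_deriv_boundary
    (f := fun r : ℝ => ‖T r.toNNReal f‖ ^ 2)
    (f' := fun r => 2 * inner ℝ (T r.toNNReal f) (T r.toNNReal g)) (a := 0) (b := t)
    (B := fun _ => ‖f‖ ^ 2) (B' := fun _ => 0)
    ((hT.continuous_orbit f).norm.pow 2).continuousOn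
    (fun x hx => (hT.hasDerivWithinAt_orbit hfg hx.1).norm_sq) (by simp [hT.zero])
    continuousOn_const (fun x _ => hasDerivWithinAt_const _ _ _)
    (fun x hx => ?_) (x := t) ⟨t.2, le_rfl⟩
  · simpa using (sq_le_sq₀ (norm_nonneg _) (norm_nonneg _)).1 key
  · have := hdiss _ _ (hT.inGeneratorGraph_apply hfg x.toNNReal)
    rw [real_inner_eq_re_inner ℂ]
    exact mul_nonpos_of_nonneg_of_nonpos zero_le_two this

/-- For `f`, `g` in the domain of the generator, `r ↦ ⟪T r f, T (t - r) g⟫` is constant on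
`[0, t]`. -/
theorem inner_apply_comm_of_symmetric (hT : IsC0Semigroup T) (hc : ∀ t, ‖T t‖ ≤ 1)
    (hd : Dense ((generator T).domain : Set H))
    (hsymm : ∀ f f' g g', InGeneratorGraph T f f' → InGeneratorGraph T g g' →
      inner ℂ f' g = inner ℂ f g') (t : ℝ≥0) (f g : H) :
    inner ℂ (T t f) g = inner ℂ f (T t g) := by
  refine hd.induction (P := fun f => inner ℂ (T t f) g = inner ℂ f (T t g)) ?_
    (isClosed_eq (by fun_prop) (by fun_prop)) f
  rintro f ⟨f', hf⟩
  refine hd.induction (P := fun g => inner ℂ (T t f) g = inner ℂ f (T t g)) ?_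
    (isClosed_eq (by fun_prop) (by fun_prop)) g
  rintro g ⟨g', hg⟩
  set ψ : ℝ → ℂ := fun r => inner ℂ (T r.toNNReal f) (T ((t : ℝ) - r).toNNReal g) with hψ
  have hcont : Continuous ψ :=
    (hT.continuous_orbit f).inner ((hT.continuous_orbit g).comp (by fun_prop))
  have key := norm_image_sub_le_of_norm_deriv_right_le_segment (f := ψ) (f' := fun _ => 0)
    (a := 0) (b := t) (C := 0) hcont.continuousOn (fun x hx => ?_) (by simp) t ⟨t.2, le_rfl⟩
  · rw [zero_mul, norm_le_zero_iff, sub_eq_zero] at key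
    simpa [hψ, hT.zero] using key
  · have h1 := hT.hasDerivWithinAt_orbit hf hx.1
    have h2 : HasDerivAt (fun r : ℝ => T ((t : ℝ) - r).toNNReal g)
        (-T ((t : ℝ) - x).toNNReal g') x := by
      have h3 := hT.hasDerivAt_orbit hc hg (sub_pos.2 hx.2)
      have h4 : HasDerivAt (fun r : ℝ => (t : ℝ) - r) (-1) x := by
        simpa using (hasDerivAt_id x).const_sub (t : ℝ)
      simpa [Function.comp_def] using h3.scomp x h4
    have h3 := h1.inner ℂ h2.hasDerivWithinAt
    refine h3.congr_deriv ?_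
    rw [hsymm _ _ _ _ (hT.inGeneratorGraph_apply hf _) (hT.inGeneratorGraph_apply hg _),
      inner_neg_right, neg_add_cancel]

end IsC0Semigroup

end Hilbert

/-! ### Exponentials of bounded dissipative operators -/

section Exponential

variable {E : Type*} [NormedAddCommGroup E] [NormedSpace ℂ E] [CompleteSpace E]

open NormedSpace

/-- A bounded accretive operator `B` generates contractions: to first order in `h` the operator
`exp (h B)` is `1 + h B`, hence expands norms up to a factor `1 - o(h)`; iterate `1 / h` times. -/
theorem norm_exp_neg_le_one {B : E →L[ℂ] E}
    (hB : ∀ (h : ℝ) (f : E), 0 ≤ h → ‖f‖ ≤ ‖f + (h : ℂ) • B f‖) : ‖exp (-B)‖ ≤ 1 := by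
  refine ContinuousLinearMap.opNorm_le_bound _ zero_le_one fun f => ?_
  rw [one_mul]
  let _ : NormedAlgebra ℚ (E →L[ℂ] E) := NormedAlgebra.restrictScalars ℚ ℂ _
  set g := exp (-B) f with hg
  have hgf : exp B g = f := by
    rw [hg, ← mul_apply_eq_comp, ← exp_add_of_commute (Commute.refl B).neg_right,
      add_neg_cancel, exp_zero, one_apply_eq_self]
  have key : ∀ ε : ℝ, 0 < ε → ε < 1 → (1 - ε) * ‖g‖ ≤ ‖f‖ := by
    intro ε hε hε1
    have hd := hasDerivAt_exp_smul_const (𝕂 := ℝ) B 0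
    rw [zero_smul, exp_zero, one_mul, hasDerivAt_iff_isLittleO_nhds_zero] at hd
    have hev := hd.def hε
    have hn : Tendsto (fun n : ℕ => ((n : ℝ) + 1)⁻¹) atTop (𝓝 0) := by
      simpa using tendsto_one_div_add_atTop_nhds_zero_nat (𝕜 := ℝ)
    obtain ⟨n, hn⟩ := (hn.eventually hev).exists
    set h : ℝ := ((n : ℝ) + 1)⁻¹ with hh
    have hpos : 0 < h := by positivity
    have hnh : ((n + 1 : ℕ) : ℝ) * h = 1 := by
      rw [hh]; push_cast; field_simp
    have hh1 : h ≤ 1 := by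
      rw [hh]; exact inv_le_one_of_one_le₀ (by linarith [n.cast_nonneg (α := ℝ)])
    simp only [zero_add, zero_smul, exp_zero] at hn
    rw [Real.norm_of_nonneg hpos.le] at hn
    have hstep : ∀ u : E, (1 - ε * h) * ‖u‖ ≤ ‖exp (h • B) u‖ := by
      intro u
      have h1 := ContinuousLinearMap.le_of_opNorm_le _ hn u
      have h2 := hB h u hpos.le
      rw [Complex.coe_smul] at h2
      have h3 : u + h • B u = exp (h • B) u - (exp (h • B) - 1 - h • B) u := by
        simp only [sub_apply, one_apply_eq_self,
          smul_apply]
        abel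
      have h4 := norm_sub_le (exp (h • B) u) ((exp (h • B) - 1 - h • B) u)
      rw [← h3] at h4
      linarith
    have hεh : ε * h < 1 := by nlinarith
    have hiter : ∀ (k : ℕ) (u : E), (1 - ε * h) ^ k * ‖u‖ ≤ ‖(exp (h • B) ^ k) u‖ := by
      intro k
      induction k with
      | zero => intro u; simp
      | succ k ih =>
        intro u
        rw [pow_succ, pow_succ, mul_apply_eq_comp, mul_assoc]
        exact (mul_le_mul_of_nonneg_left (hstep u) (pow_nonneg (by linarith) k)).trans (ih _)
    have hpow : exp (h • B) ^ (n + 1) = exp B := by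
      rw [← exp_nsmul, ← Nat.cast_smul_eq_nsmul ℝ, smul_smul, hnh, one_smul]
    have hber := one_add_mul_le_pow (a := -(ε * h)) (by linarith) (n + 1)
    have h5 := hiter (n + 1) g
    rw [hpow, hgf] at h5
    refine le_trans (mul_le_mul_of_nonneg_right ?_ (norm_nonneg _)) h5
    have : ((n + 1 : ℕ) : ℝ) * (-(ε * h)) = -ε := by linear_combination (-ε) * hnh
    rw [this] at hber
    simpa [sub_eq_add_neg] using hber
  have hlim : Tendsto (fun ε : ℝ => (1 - ε) * ‖g‖) (𝓝[>] 0) (𝓝 ((1 - 0) * ‖g‖)) :=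
    ((by fun_prop : Continuous fun ε : ℝ => (1 - ε) * ‖g‖).tendsto 0).mono_left nhdsWithin_le_nhds
  rw [sub_zero, one_mul] at hlim
  refine le_of_tendsto hlim ?_
  filter_upwards [self_mem_nhdsWithin,
    (eventually_lt_nhds (zero_lt_one (α := ℝ))).filter_mono nhdsWithin_le_nhds] with ε h1 h2
  exact key ε h1 h2

/-- Duhamel estimate: the derivative of `r ↦ exp (r X) exp ((1 - r) Y) f` is
`exp (r X) exp ((1 - r) Y) (X - Y) f`. -/
theorem norm_exp_sub_exp_apply_le {X Y : E →L[ℂ] E} (hXY : Commute X Y)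
    (hX : ∀ r : ℝ, 0 ≤ r → ‖exp (r • X)‖ ≤ 1) (hY : ∀ r : ℝ, 0 ≤ r → ‖exp (r • Y)‖ ≤ 1) (f : E) :
    ‖exp X f - exp Y f‖ ≤ ‖(X - Y) f‖ := by
  set Ψ : ℝ → E →L[ℂ] E := fun r => exp (r • X) * exp ((1 - r) • Y) with hΨ
  have hd : ∀ r, HasDerivAt Ψ (exp (r • X) * exp ((1 - r) • Y) * (X - Y)) r := by
    intro r
    have h1 := hasDerivAt_exp_smul_const (𝕂 := ℝ) X r
    have h2 : HasDerivAt (fun r : ℝ => 1 - r) (-1) r := by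
      simpa using (hasDerivAt_id r).const_sub (1 : ℝ)
    have h3 := (hasDerivAt_exp_smul_const (𝕂 := ℝ) Y (1 - r)).scomp r h2
    refine (h1.mul h3).congr_deriv ?_
    have hc : X * exp ((1 - r) • Y) = exp ((1 - r) • Y) * X :=
      ((hXY.smul_right (1 - r)).exp_right).eq
    simp only [Function.comp, neg_smul, one_smul, mul_assoc, hc, mul_sub, mul_neg]
    abel
  have hdf : ∀ r, HasDerivAt (fun r => Ψ r f)
      ((exp (r • X) * exp ((1 - r) • Y) * (X - Y)) f) r := fun r =>
    ((ContinuousLinearMap.apply ℂ E f).restrictScalars ℝ).hasFDerivAt.comp_hasDerivAt r (hd r)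
  have key := norm_image_sub_le_of_norm_deriv_right_le_segment (f := fun r => Ψ r f)
    (a := 0) (b := 1) (C := ‖(X - Y) f‖) (fun r _ => (hdf r).continuousAt.continuousWithinAt)
    (fun r _ => (hdf r).hasDerivWithinAt) (fun r hr => ?_) 1 ⟨zero_le_one, le_rfl⟩
  · simpa [hΨ] using key
  · rw [mul_assoc, mul_apply_eq_comp, mul_apply_eq_comp]
    refine (ContinuousLinearMap.le_of_opNorm_le _ (hX r hr.1) _).trans ?_
    rw [one_mul]
    refine (ContinuousLinearMap.le_of_opNorm_le _ (hY (1 - r) (by linarith [hr.2])) _).trans ?_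
    rw [one_mul]

variable {T : ℝ≥0 → E →L[ℂ] E}

/-- Comparison of `T` with the semigroup generated by a bounded operator commuting with it:
`r ↦ exp (-(t - r) B) T r f` runs from `exp (-t B) f` to `T t f`, and its right derivative has norm
at most `‖B f + g‖`. -/
theorem IsC0Semigroup.norm_apply_sub_exp_le (hT : IsC0Semigroup T) (hc : ∀ t, ‖T t‖ ≤ 1)
    {B : E →L[ℂ] E} (hB : ∀ r : ℝ, 0 ≤ r → ‖exp (-(r • B))‖ ≤ 1) (hBT : ∀ t, Commute B (T t))
    {f g : E} (hfg : InGeneratorGraph T f g) (t : ℝ≥0) :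
    ‖T t f - exp (-((t : ℝ) • B)) f‖ ≤ t * ‖B f + g‖ := by
  set Φ : ℝ → E →L[ℂ] E := fun r => exp ((r - t) • B) with hΦ
  have hΦd : ∀ r, HasDerivAt Φ (Φ r * B) r := by
    intro r
    have h2 : HasDerivAt (fun r : ℝ => r - t) 1 r := (hasDerivAt_id r).sub_const (t : ℝ)
    simpa [Function.comp_def] using
      (hasDerivAt_exp_smul_const (𝕂 := ℝ) B (r - t)).scomp r h2
  have hd : ∀ r, 0 ≤ r → HasDerivWithinAt (fun r => Φ r (T r.toNNReal f))
      (Φ r (T r.toNNReal (B f + g))) (Set.Ici r) r := by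
    intro r hr
    have h1 := (ContinuousLinearMap.restrictScalarsL ℂ E E ℝ ℝ).hasFDerivAt.comp_hasDerivAt r
      (hΦd r)
    have h2 := h1.hasDerivWithinAt.clm_apply (hT.hasDerivWithinAt_orbit hfg hr)
    refine h2.congr_deriv ?_
    have hcomm : B (T r.toNNReal f) = T r.toNNReal (B f) :=
      DFunLike.congr_fun (hBT r.toNNReal).eq f
    simp [hcomm]
  have hcont : Continuous fun r => Φ r (T r.toNNReal f) :=
    (continuous_iff_continuousAt.2 fun r => (hΦd r).continuousAt).clm_apply
      (hT.continuous_orbit f)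
  have key := norm_image_sub_le_of_norm_deriv_right_le_segment
    (f := fun r => Φ r (T r.toNNReal f)) (a := 0) (b := t) (C := ‖B f + g‖) hcont.continuousOn
    (fun r hr => hd r hr.1) (fun r hr => ?_) t ⟨t.2, le_rfl⟩
  · rw [sub_zero, mul_comm] at key
    simpa [hΦ, hT.zero] using key
  · have h1 : ‖Φ r‖ ≤ 1 := by
      have := hB (t - r) (by linarith [hr.2])
      rwa [← neg_smul, neg_sub] at this
    refine (ContinuousLinearMap.le_of_opNorm_le _ h1 _).trans ?_
    rw [one_mul]
    refine (ContinuousLinearMap.le_of_opNorm_le _ (hc _) _).trans ?_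
    rw [one_mul]

end Exponential

/-! ### From strong to norm holomorphy -/

/-- A bounded, strongly holomorphic operator-valued function is holomorphic in operator norm. The
Schwarz lemma, applied twice, bounds the second-order difference quotient of `z ↦ S z f` by a
multiple of `‖f‖`, uniformly in `f`. -/
theorem differentiableAt_of_strongly_holomorphic {E F : Type*} [NormedAddCommGroup E]
    [NormedSpace ℂ E] [NormedAddCommGroup F] [NormedSpace ℂ F] [CompleteSpace F]
    {S : ℂ → E →L[ℂ] F} {z₀ : ℂ} {R M : ℝ}
    (hR : 0 < R) (hM : ∀ z ∈ Metric.ball z₀ R, ‖S z‖ ≤ M)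
    (hS : ∀ f, DifferentiableOn ℂ (fun z => S z f) (Metric.ball z₀ R)) :
    DifferentiableAt ℂ S z₀ := by
  have hz₀ : z₀ ∈ Metric.ball z₀ R := Metric.mem_ball_self hR
  have hM0 : 0 ≤ M := (norm_nonneg _).trans (hM z₀ hz₀)
  have hdiff : ∀ f, DifferentiableAt ℂ (fun z => S z f) z₀ := fun f =>
    (hS f).differentiableAt (Metric.isOpen_ball.mem_nhds hz₀)
  have hbd : ∀ f, ∀ z ∈ Metric.ball z₀ R,
      ‖dslope (fun z => S z f) z₀ z‖ ≤ 2 * M * ‖f‖ / R := by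
    intro f z hz
    refine Complex.norm_dslope_le_div_of_mapsTo_ball (hS f) (fun w hw => ?_) hz
    rw [mem_closedBall_iff_norm]
    calc ‖S w f - S z₀ f‖ ≤ ‖S w f‖ + ‖S z₀ f‖ := norm_sub_le _ _
      _ ≤ M * ‖f‖ + M * ‖f‖ := add_le_add ((S w).le_of_opNorm_le (hM w hw) f)
          ((S z₀).le_of_opNorm_le (hM z₀ hz₀) f)
      _ = 2 * M * ‖f‖ := by ring
  have hbd2 : ∀ f, ∀ z ∈ Metric.ball z₀ R,
      ‖dslope (dslope (fun z => S z f) z₀) z₀ z‖ ≤ 2 * (2 * M * ‖f‖ / R) / R := by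
    intro f z hz
    refine Complex.norm_dslope_le_div_of_mapsTo_ball
      ((Complex.differentiableOn_dslope (Metric.isOpen_ball.mem_nhds hz₀)).2 (hS f))
      (fun w hw => ?_) hz
    rw [mem_closedBall_iff_norm]
    exact (norm_sub_le _ _).trans (by linarith [hbd f w hw, hbd f z₀ hz₀])
  let D : E →L[ℂ] F := LinearMap.mkContinuous
    { toFun := fun f => deriv (fun z => S z f) z₀
      map_add' := fun f g => by
        simp only [map_add]
        exact deriv_add (hdiff f) (hdiff g)
      map_smul' := fun c f => by
        simp only [map_smul, RingHom.id_apply]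
        exact deriv_const_smul c (hdiff f) } (2 * M / R) fun f => by
    have := hbd f z₀ hz₀
    rw [dslope_same] at this
    calc ‖deriv (fun z => S z f) z₀‖ ≤ 2 * M * ‖f‖ / R := this
      _ = 2 * M / R * ‖f‖ := by ring
  have hDer : HasDerivAt S D z₀ := by
    rw [hasDerivAt_iff_isLittleO]
    have hO : (fun z => S z - S z₀ - (z - z₀) • D) =O[𝓝 z₀] fun z => (z - z₀) ^ 2 := by
      refine Asymptotics.IsBigO.of_bound (2 * (2 * M / R) / R) ?_
      filter_upwards [Metric.ball_mem_nhds z₀ hR] with z hz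
      rw [norm_pow]
      refine ContinuousLinearMap.opNorm_le_bound _ (by positivity) fun f => ?_
      have h1 : (S z - S z₀ - (z - z₀) • D) f =
          (z - z₀) • (z - z₀) • dslope (dslope (fun z => S z f) z₀) z₀ z := by
        rw [sub_smul_dslope, smul_sub, sub_smul_dslope, dslope_same]
        rfl
      rw [h1, norm_smul, norm_smul]
      calc ‖z - z₀‖ * (‖z - z₀‖ * ‖dslope (dslope (fun z => S z f) z₀) z₀ z‖)
          ≤ ‖z - z₀‖ * (‖z - z₀‖ * (2 * (2 * M * ‖f‖ / R) / R)) := by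
            gcongr; exact hbd2 f z hz
        _ = _ := by ring
    refine hO.trans_isLittleO ?_
    have := (Asymptotics.isLittleO_pow_id (𝕜 := ℂ) (n := 2) (by norm_num))
    have h2 : Tendsto (fun z : ℂ => z - z₀) (𝓝 z₀) (𝓝 0) := by
      have : Tendsto (fun z : ℂ => z - z₀) (𝓝 z₀) (𝓝 (z₀ - z₀)) :=
        (by fun_prop : Continuous fun z : ℂ => z - z₀).tendsto z₀
      rwa [sub_self] at this
    exact this.comp_tendsto h2
  exact hDer.differentiableAt

/-! ### Analytic extension -/

section AnalyticExtension

variable {E : Type*} [NormedAddCommGroup E] [NormedSpace ℂ E] {T : ℝ≥0 → E →L[ℂ] E}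

open NormedSpace

/-- The bounded approximation `(n + 1) (1 - T (1 / (n + 1)))` of the negative generator. -/
noncomputable def difference (T : ℝ≥0 → E →L[ℂ] E) (n : ℕ) : E →L[ℂ] E :=
  ((n : ℝ) + 1) • (1 - T ((n : ℝ) + 1)⁻¹.toNNReal)

theorem tendsto_difference_apply {f g : E} (h : InGeneratorGraph T f g) :
    Tendsto (fun n => difference T n f) atTop (𝓝 (-g)) := by
  have hu : Tendsto (fun n : ℕ => ((n : ℝ) + 1)⁻¹) atTop (𝓝[>] 0) := by
    rw [tendsto_nhdsWithin_iff]
    refine ⟨by simpa using tendsto_one_div_add_atTop_nhds_zero_nat (𝕜 := ℝ), ?_⟩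
    exact Eventually.of_forall fun n => Set.mem_Ioi.2 (by positivity)
  refine (h.tendsto_real hu).neg.congr fun n => ?_
  rw [difference, ← smul_neg, neg_sub, inv_inv]
  rfl

theorem IsC0Semigroup.commute_difference_apply (hT : IsC0Semigroup T) (n : ℕ) (t : ℝ≥0) :
    Commute (difference T n) (T t) :=
  ((Commute.one_left _).sub_left (hT.commute _ _)).smul_left _

theorem IsC0Semigroup.commute_difference (hT : IsC0Semigroup T) (n m : ℕ) :
    Commute (difference T n) (difference T m) :=
  ((Commute.one_right _).sub_right (hT.commute_difference_apply n _)).smul_right _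

variable {φ : ℝ}

theorem norm_exp_neg_smul_difference_le (h₀ : 0 ≤ φ) (h₁ : φ ≤ Real.pi / 2)
    (h : ∀ z ∈ closedSector φ, ∀ t, ‖exp (-(z • (1 - T t)))‖ ≤ 1) {z : ℂ}
    (hz : z ∈ closedSector φ) (n : ℕ) : ‖exp (-(z • difference T n))‖ ≤ 1 := by
  have hn : (0 : ℝ) ≤ (n : ℝ) + 1 := by positivity
  have := h _ (smul_mem_closedSector h₀ h₁ hz hn) ((n : ℝ) + 1)⁻¹.toNNReal
  rwa [mul_comm, mul_smul, Complex.coe_smul] at this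

variable [CompleteSpace E]

theorem IsC0Semigroup.norm_exp_difference_sub_le (hT : IsC0Semigroup T) (h₀ : 0 ≤ φ)
    (h₁ : φ ≤ Real.pi / 2) (h : ∀ z ∈ closedSector φ, ∀ t, ‖exp (-(z • (1 - T t)))‖ ≤ 1) {z : ℂ}
    (hz : z ∈ closedSector φ) (n m : ℕ) (f : E) :
    ‖exp (-(z • difference T n)) f - exp (-(z • difference T m)) f‖ ≤
      ‖z‖ * ‖difference T n f - difference T m f‖ := by
  have hb : ∀ n, ∀ r : ℝ, 0 ≤ r → ‖exp (r • -(z • difference T n))‖ ≤ 1 := by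
    intro n r hr
    have := norm_exp_neg_smul_difference_le h₀ h₁ h (smul_mem_closedSector h₀ h₁ hz hr) n
    rwa [mul_smul, Complex.coe_smul, ← smul_neg] at this
  have hcomm : Commute (-(z • difference T n)) (-(z • difference T m)) :=
    (((hT.commute_difference n m).smul_left z).smul_right z).neg_left.neg_right
  refine (norm_exp_sub_exp_apply_le hcomm (hb n) (hb m) f).trans_eq ?_
  have : (-(z • difference T n) - -(z • difference T m)) f =
      -(z • (difference T n f - difference T m f)) := by
    simp only [sub_apply, neg_apply, smul_apply, smul_sub]
    abel
  rw [this, norm_neg, norm_smul]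

/-- The approximations `exp (-z B_n) f` converge uniformly on bounded parts of the closed sector:
for `f` in the domain of the generator this is the Duhamel estimate, as `B_n f` converges. -/
theorem IsC0Semigroup.uniformCauchySeqOn_exp_difference (hT : IsC0Semigroup T) (h₀ : 0 ≤ φ)
    (h₁ : φ ≤ Real.pi / 2) (h : ∀ z ∈ closedSector φ, ∀ t, ‖exp (-(z • (1 - T t)))‖ ≤ 1)
    (f : E) (R : ℝ) :
    UniformCauchySeqOn (fun n z => exp (-(z • difference T n)) f) atTop
      (closedSector φ ∩ Metric.ball 0 R) := by
  rw [Metric.uniformCauchySeqOn_iff]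
  intro ε hε
  obtain ⟨f', hf', hff'⟩ := Metric.dense_iff.1 hT.dense_domain_generator f (ε / 4) (by linarith)
  obtain ⟨g, hg⟩ := hff'
  have hc := (tendsto_difference_apply hg).cauchySeq
  have hR : 0 < |R| + 1 := by positivity
  obtain ⟨N, hN⟩ := Metric.cauchySeq_iff.1 hc (ε / 2 / (|R| + 1)) (by positivity)
  refine ⟨N, fun n hn m hm z hz => ?_⟩
  have hfd : ‖f - f'‖ < ε / 4 := by
    rw [← dist_eq_norm, dist_comm]; exact hf'
  have hbd : ∀ n, ‖exp (-(z • difference T n)) f - exp (-(z • difference T n)) f'‖ ≤ ‖f - f'‖ := by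
    intro n
    rw [← map_sub]
    exact (ContinuousLinearMap.le_of_opNorm_le _
      (norm_exp_neg_smul_difference_le h₀ h₁ h hz.1 n) _).trans_eq (one_mul _)
  have hmid := hT.norm_exp_difference_sub_le h₀ h₁ h hz.1 n m f'
  have hz2 : ‖z‖ ≤ |R| + 1 := by
    have := mem_ball_zero_iff.1 hz.2
    linarith [le_abs_self R]
  have hdn := hN n hn m hm
  rw [dist_eq_norm] at hdn
  have hmid2 : ‖z‖ * ‖difference T n f' - difference T m f'‖ ≤ ε / 2 := by
    calc _ ≤ (|R| + 1) * (ε / 2 / (|R| + 1)) := by gcongr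
      _ = ε / 2 := by field_simp
  rw [dist_eq_norm]
  have e1 := hbd n
  have e2 := hbd m
  rw [norm_sub_rev] at e2
  have := norm_add₃_le (a := exp (-(z • difference T n)) f - exp (-(z • difference T n)) f')
    (b := exp (-(z • difference T n)) f' - exp (-(z • difference T m)) f')
    (c := exp (-(z • difference T m)) f' - exp (-(z • difference T m)) f)
  rw [show ∀ a b c d : E, a - b + (b - c) + (c - d) = a - d from fun a b c d => by abel] at this
  linarith

theorem differentiable_exp_neg_smul_apply (B : E →L[ℂ] E) (f : E) :
    Differentiable ℂ fun z : ℂ => exp (-(z • B)) f := by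
  have : Differentiable ℂ fun z : ℂ => exp (z • -B) := fun z =>
    (hasDerivAt_exp_smul_const (-B) z).differentiableAt
  simp only [smul_neg] at this
  exact this.clm_apply (differentiable_const f)

/-- A contraction semigroup `T` for which the operators `exp (-z (1 - T t))`, with `z` in a
closed sector, are contractions, extends to an analytic contraction semigroup on that sector. -/
theorem IsC0Semigroup.exists_analytic_extension (hT : IsC0Semigroup T) (hc : ∀ t, ‖T t‖ ≤ 1)
    (h₀ : 0 ≤ φ) (h₁ : φ ≤ Real.pi / 2)
    (h : ∀ z ∈ closedSector φ, ∀ t, ‖exp (-(z • (1 - T t)))‖ ≤ 1) :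
    ∃ S : ℂ → E →L[ℂ] E, IsAnalyticContractionSemigroup φ S ∧ ∀ t : ℝ≥0, S ((t : ℝ) : ℂ) = T t := by
  have hK := fun {z : ℂ} (hz : z ∈ closedSector φ) n =>
    norm_exp_neg_smul_difference_le h₀ h₁ h hz n
  have hex : ∀ z, ∃ Sz : E →L[ℂ] E, z ∈ closedSector φ →
      ∀ f, Tendsto (fun n => exp (-(z • difference T n)) f) atTop (𝓝 (Sz f)) := by
    intro z
    by_cases hz : z ∈ closedSector φ
    · have hl : ∀ f, ∃ y, Tendsto (fun n => exp (-(z • difference T n)) f) atTop (𝓝 y) := fun f =>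
        cauchySeq_tendsto_of_complete
          ((hT.uniformCauchySeqOn_exp_difference h₀ h₁ h f (‖z‖ + 1)).cauchySeq
            ⟨hz, mem_ball_zero_iff.2 (lt_add_one _)⟩)
      choose y hy using hl
      refine ⟨continuousLinearMapOfTendsto (l := atTop)
        (fun n => exp (-(z • difference T n))) (f := y) (tendsto_pi_nhds.2 hy), fun _ => hy⟩
    · exact ⟨0, fun hz' => absurd hz' hz⟩
  choose S hS using hex
  have hSle : ∀ z ∈ closedSector φ, ‖S z‖ ≤ 1 := by
    intro z hz
    refine (S z).opNorm_le_bound zero_le_one fun f => ?_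
    exact le_of_tendsto (hS z hz f).norm (Eventually.of_forall fun n =>
      ContinuousLinearMap.le_of_opNorm_le _ (hK hz n) f)
  have hunif : ∀ f, TendstoLocallyUniformlyOn (fun n z => exp (-(z • difference T n)) f)
      (fun z => S z f) atTop (closedSector φ) := by
    intro f
    rw [tendstoLocallyUniformlyOn_iff_forall_tendsto]
    intro z hz
    have hu := (hT.uniformCauchySeqOn_exp_difference h₀ h₁ h f
      (‖z‖ + 1)).tendstoUniformlyOn_of_tendsto (fun w hw => hS w hw.1 f)
    rw [tendstoUniformlyOn_iff_tendsto] at hu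
    refine hu.mono_left (Filter.prod_mono le_rfl ?_)
    rw [le_principal_iff, Set.inter_comm]
    exact inter_mem (mem_nhdsWithin_of_mem_nhds (Metric.isOpen_ball.mem_nhds
      (mem_ball_zero_iff.2 (lt_add_one _)))) self_mem_nhdsWithin
  -- On the positive half-line the approximations converge to `T` on the domain of the generator.
  have hST : ∀ t : ℝ≥0, S ((t : ℝ) : ℂ) = T t := by
    intro t
    have hmem : ∀ r : ℝ, 0 ≤ r → (r : ℂ) ∈ closedSector φ := fun r hr =>
      ofReal_mem_closedSector h₀ h₁ hr
    ext f
    refine hT.dense_domain_generator.induction (P := fun f => S ((t : ℝ) : ℂ) f = T t f) ?_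
      (isClosed_eq (by fun_prop) (by fun_prop)) f
    rintro f ⟨g, hfg⟩
    refine tendsto_nhds_unique (hS _ (hmem t t.2) f) ?_
    rw [tendsto_iff_norm_sub_tendsto_zero]
    have hlim : Tendsto (fun n => (t : ℝ) * ‖difference T n f + g‖) atTop (𝓝 0) := by
      have := (((tendsto_difference_apply hfg).add_const g).norm).const_mul (t : ℝ)
      simpa using this
    refine squeeze_zero (fun n => norm_nonneg _) (fun n => ?_) hlim
    rw [norm_sub_rev, Complex.coe_smul]
    refine hT.norm_apply_sub_exp_le hc (fun r hr => ?_) (hT.commute_difference_apply n) hfg t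
    have := hK (hmem r hr) n
    rwa [Complex.coe_smul] at this
  refine ⟨S, ⟨?_, ?_, hSle, ?_, ?_⟩, hST⟩
  · have := hST 0
    rwa [hT.zero, NNReal.coe_zero, Complex.ofReal_zero] at this
  · intro z hz w hw
    let _ : NormedAlgebra ℚ (E →L[ℂ] E) := NormedAlgebra.restrictScalars ℚ ℂ _
    ext f
    refine tendsto_nhds_unique (hS _ (add_mem_closedSector h₀ h₁ hz hw) f) ?_
    have e : ∀ n, exp (-((z + w) • difference T n)) f =
        exp (-(z • difference T n)) (exp (-(w • difference T n)) f - S w f) +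
          exp (-(z • difference T n)) (S w f) := by
      intro n
      have hcomm : Commute (-(z • difference T n)) (-(w • difference T n)) :=
        (((Commute.refl _).smul_left z).smul_right w).neg_left.neg_right
      rw [map_sub, sub_add_cancel, add_smul, neg_add, exp_add_of_commute hcomm]
      rfl
    simp only [e]
    have h1 : Tendsto (fun n => exp (-(z • difference T n)) (exp (-(w • difference T n)) f - S w f))
        atTop (𝓝 0) := by
      have h2 := (hS w hw f).sub_const (S w f)
      rw [sub_self] at h2
      refine squeeze_zero_norm (fun n => ?_) (tendsto_zero_iff_norm_tendsto_zero.1 h2)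
      exact (ContinuousLinearMap.le_of_opNorm_le _ (hK hz n) _).trans_eq (one_mul _)
    simpa using h1.add (hS z hz (S w f))
  · intro f
    refine (hunif f).continuousOn (Frequently.of_forall fun n => ?_)
    exact (differentiable_exp_neg_smul_apply (difference T n) f).continuous.continuousOn
  · intro z₀ hz₀
    have hopen := isOpen_openSector h₁
    obtain ⟨R, hR, hball⟩ := Metric.isOpen_iff.1 hopen z₀ hz₀
    refine (differentiableAt_of_strongly_holomorphic hR
      (fun z hz => hSle z (openSector_subset_closedSector φ (hball hz)))
      fun f => ?_).differentiableWithinAt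
    refine (((hunif f).mono (openSector_subset_closedSector φ)).differentiableOn
      (Eventually.of_forall fun n => ?_) hopen).mono hball
    exact (differentiable_exp_neg_smul_apply (difference T n) f).differentiableOn

end AnalyticExtension

/-! ### Step functions and the matrix of a symmetric contraction -/

section Step

variable {Ω ι : Type*} [Fintype ι]

/-- The function with value `c i` on `A i` and `0` elsewhere, when the sets `A i` are disjoint. -/
noncomputable def stepFun (A : ι → Set Ω) (c : ι → ℂ) (x : Ω) : ℂ :=
  ∑ i, (A i).indicator (fun _ => c i) x

/-- At each point a step function over disjoint sets takes one of its values, or `0`, and which one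
depends on the sets only. -/
theorem stepFun_eq_or {A : ι → Set Ω} (hA : Pairwise fun i j => Disjoint (A i) (A j)) (x : Ω) :
    (∃ i, ∀ c : ι → ℂ, stepFun A c x = c i) ∨ ∀ c : ι → ℂ, stepFun A c x = 0 := by
  by_cases h : ∃ i, x ∈ A i
  · obtain ⟨i, hi⟩ := h
    refine Or.inl ⟨i, fun c => ?_⟩
    rw [stepFun, Finset.sum_eq_single i, Set.indicator_of_mem hi]
    · intro j _ hj
      exact Set.indicator_of_notMem (fun hx => (hA hj).le_bot ⟨hx, hi⟩) _
    · simp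
  · push Not at h
    exact Or.inr fun c => Finset.sum_eq_zero fun i _ => Set.indicator_of_notMem (h i) _

theorem map_stepFun {A : ι → Set Ω} (hA : Pairwise fun i j => Disjoint (A i) (A j)) {F : ℂ → ℂ}
    (hF : F 0 = 0) (c : ι → ℂ) (x : Ω) : F (stepFun A c x) = stepFun A (F ∘ c) x := by
  rcases stepFun_eq_or hA x with ⟨i, hi⟩ | h
  · rw [hi, hi]; rfl
  · rw [h, h, hF]

variable [MeasurableSpace Ω] {μ : Measure Ω}

theorem exists_stepFun_eq {q : ℝ≥0∞} (hq0 : q ≠ 0) (hq : q ≠ ∞) (f : SimpleFunc Ω ℂ)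
    (hf : MemLp f q μ) :
    ∃ (s : Finset ℂ) (A : s → Set Ω) (c : s → ℂ), (Pairwise fun i j => Disjoint (A i) (A j)) ∧
      (∀ i, MeasurableSet (A i)) ∧ (∀ i, μ (A i) ≠ ∞) ∧ ∀ x, f x = stepFun A c x := by
  classical
  refine ⟨f.range.filter (· ≠ 0), fun i => f ⁻¹' {(i : ℂ)}, fun i => i, ?_, ?_, ?_, ?_⟩
  · intro i j hij
    refine Disjoint.preimage f (Set.disjoint_singleton.2 fun h => hij (Subtype.ext h))
  · exact fun i => f.measurableSet_fiber i
  · intro i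
    exact (SimpleFunc.measure_preimage_lt_top_of_memLp hq0 hq f hf i
      (Finset.mem_filter.1 i.2).2).ne
  · intro x
    by_cases hx : f x = 0
    · rw [stepFun, hx]
      refine (Finset.sum_eq_zero fun i _ => Set.indicator_of_notMem ?_ _).symm
      intro h
      exact (Finset.mem_filter.1 i.2).2 ((Set.mem_singleton_iff.1 h).symm.trans hx)
    · rw [stepFun, Finset.sum_eq_single ⟨f x, Finset.mem_filter.2 ⟨f.mem_range_self x, hx⟩⟩]
      · simp
      · rintro i - hi
        refine Set.indicator_of_notMem (fun h => hi (Subtype.ext ?_)) _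
        exact (Set.mem_singleton_iff.1 h).symm
      · simp

variable {A : ι → Set Ω}

theorem eLpNorm_stepFun_top_le (hA : Pairwise fun i j => Disjoint (A i) (A j)) {c : ι → ℂ}
    (hc : ∀ i, ‖c i‖ ≤ 1) : eLpNorm (stepFun A c) ∞ μ ≤ 1 := by
  have := eLpNormEssSup_le_of_ae_bound (μ := μ) (f := stepFun A c) (C := 1)
    (Eventually.of_forall fun x => ?_)
  · simpa using this
  · rcases stepFun_eq_or hA x with ⟨i, hi⟩ | h
    · rw [hi]; exact hc i
    · rw [h]; simp

theorem integral_norm_rpow_stepFun (hA : Pairwise fun i j => Disjoint (A i) (A j))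
    (hm : ∀ i, MeasurableSet (A i)) (hμ : ∀ i, μ (A i) ≠ ∞) (c : ι → ℂ) {r : ℝ} (hr : 0 < r) :
    ∫ x, ‖stepFun A c x‖ ^ r ∂μ = ∑ i, ‖c i‖ ^ r * μ.real (A i) := by
  have h : ∀ x, ‖stepFun A c x‖ ^ r = ∑ i, (A i).indicator (fun _ => ‖c i‖ ^ r) x := by
    intro x
    have h1 := map_stepFun hA (F := fun z => ((‖z‖ ^ r : ℝ) : ℂ))
      (by simp [Real.zero_rpow hr.ne']) c x
    apply Complex.ofReal_injective
    rw [h1, stepFun, Complex.ofReal_sum]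
    refine Finset.sum_congr rfl fun i _ => ?_
    by_cases hx : x ∈ A i <;> simp [hx]
  simp_rw [h]
  rw [integral_finsetSum]
  · refine Finset.sum_congr rfl fun i _ => ?_
    rw [integral_indicator_const _ (hm i), smul_eq_mul, mul_comm]
  · intro i _
    exact (integrable_indicator_iff (hm i)).2 (integrableOn_const (hμ i))

/-- The element of `L²` represented by a step function. -/
noncomputable def stepLp (hm : ∀ i, MeasurableSet (A i)) (hμ : ∀ i, μ (A i) ≠ ∞) (c : ι → ℂ) :
    Lp ℂ 2 μ :=
  ∑ i, c i • indicatorConstLp 2 (hm i) (hμ i) (1 : ℂ)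

theorem coeFn_stepLp (hm : ∀ i, MeasurableSet (A i)) (hμ : ∀ i, μ (A i) ≠ ∞) (c : ι → ℂ) :
    stepLp hm hμ c =ᵐ[μ] stepFun A c := by
  have h : ∀ i, (c i • indicatorConstLp 2 (hm i) (hμ i) (1 : ℂ) : Lp ℂ 2 μ) =ᵐ[μ]
      (A i).indicator fun _ => c i := by
    intro i
    filter_upwards [Lp.coeFn_smul (c i) (indicatorConstLp 2 (hm i) (hμ i) (1 : ℂ)),
      indicatorConstLp_coeFn (p := 2) (hs := hm i) (hμs := hμ i) (c := (1 : ℂ))] with x h1 h2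
    rw [h1, Pi.smul_apply, h2]
    by_cases hx : x ∈ A i <;> simp [hx]
  have h2 := Lp.coeFn_finsetSum Finset.univ
    (fun i => (c i • indicatorConstLp 2 (hm i) (hμ i) (1 : ℂ) : Lp ℂ 2 μ))
  filter_upwards [h2, eventually_all.2 h] with x hx hx'
  rw [stepLp, hx, stepFun]
  simp only [Finset.sum_apply]
  exact Finset.sum_congr rfl fun i _ => hx' i

end Step

theorem Complex.exists_unit_mul_eq_norm (z : ℂ) : ∃ ε : ℂ, ‖ε‖ = 1 ∧ ε * z = ‖z‖ := by
  by_cases hz : z = 0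
  · exact ⟨1, by simp, by simp [hz]⟩
  · have hn : (‖z‖ : ℂ) ≠ 0 := by simpa using hz
    refine ⟨conj z / ‖z‖, ?_, ?_⟩
    · rw [norm_div, RCLike.norm_conj, Complex.norm_real, norm_norm,
        div_self (norm_ne_zero_iff.2 hz)]
    · rw [div_mul_eq_mul_div, Complex.conj_mul']
      field_simp

section Matrix

variable {Ω ι κ : Type*} [MeasurableSpace Ω] {μ : Measure Ω} {T : Lp ℂ 2 μ →L[ℂ] Lp ℂ 2 μ}

/-- A symmetric operator on `L²` which is contractive for the `L^∞` norm on `L² ∩ L^∞`. -/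
structure IsSymmetricContraction (T : Lp ℂ 2 μ →L[ℂ] Lp ℂ 2 μ) : Prop where
  symm : ∀ f g, inner ℂ (T f) g = inner ℂ f (T g)
  contractive : ∀ f : Lp ℂ 2 μ, MemLp f ∞ μ → eLpNorm (T f) ∞ μ ≤ eLpNorm f ∞ μ

variable {A : ι → Set Ω} {B : κ → Set Ω} (hmA : ∀ i, MeasurableSet (A i)) (hμA : ∀ i, μ (A i) ≠ ∞)
  (hmB : ∀ i, MeasurableSet (B i)) (hμB : ∀ i, μ (B i) ≠ ∞)

/-- The matrix entries `⟨1_{B j}, T 1_{A i}⟩`. -/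
noncomputable def matrixEntry (T : Lp ℂ 2 μ →L[ℂ] Lp ℂ 2 μ) (hmA : ∀ i, MeasurableSet (A i))
    (hμA : ∀ i, μ (A i) ≠ ∞) (hmB : ∀ i, MeasurableSet (B i)) (hμB : ∀ i, μ (B i) ≠ ∞)
    (j : κ) (i : ι) : ℂ :=
  inner ℂ (indicatorConstLp 2 (hmB j) (hμB j) (1 : ℂ))
    (T (indicatorConstLp 2 (hmA i) (hμA i) (1 : ℂ)))

theorem IsSymmetricContraction.conj_matrixEntry (hT : IsSymmetricContraction T) (i : ι) (j : κ) :
    conj (matrixEntry T hmA hμA hmB hμB j i) = matrixEntry T hmB hμB hmA hμA i j := by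
  rw [matrixEntry, inner_conj_symm, hT.symm, matrixEntry]

theorem IsSymmetricContraction.norm_matrixEntry_comm (hT : IsSymmetricContraction T) (i : ι)
    (j : κ) : ‖matrixEntry T hmA hμA hmB hμB j i‖ = ‖matrixEntry T hmB hμB hmA hμA i j‖ := by
  rw [← hT.conj_matrixEntry hmA hμA hmB hμB, RCLike.norm_conj]

variable [Fintype ι]

/-- Row sums of the matrix: test `T` on a step function of modulus `1` with suitable phases. -/
theorem IsSymmetricContraction.sum_norm_matrixEntry_le (hT : IsSymmetricContraction T)
    (hA : Pairwise fun i j => Disjoint (A i) (A j)) (j : κ) :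
    ∑ i, ‖matrixEntry T hmA hμA hmB hμB j i‖ ≤ μ.real (B j) := by
  choose ε hε hεm using fun i => Complex.exists_unit_mul_eq_norm
    (matrixEntry T hmA hμA hmB hμB j i)
  set u := stepLp hmA hμA ε with hu
  have hu1 : eLpNorm u ∞ μ ≤ 1 := by
    rw [eLpNorm_congr_ae (coeFn_stepLp hmA hμA ε)]
    exact eLpNorm_stepFun_top_le hA fun i => (hε i).le
  have hu2 : MemLp u ∞ μ := ⟨Lp.aestronglyMeasurable u, hu1.trans_lt ENNReal.one_lt_top⟩
  have hTu : ∀ᵐ x ∂μ, ‖T u x‖ ≤ 1 := by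
    have h1 := (hT.contractive u hu2).trans hu1
    rw [eLpNorm_exponent_top] at h1
    filter_upwards [enorm_ae_le_eLpNormEssSup (T u) μ] with x hx
    have := hx.trans h1
    rwa [← ofReal_norm, ENNReal.ofReal_le_one] at this
  have hsum : (inner ℂ (indicatorConstLp 2 (hmB j) (hμB j) (1 : ℂ)) (T u)) =
      ((∑ i, ‖matrixEntry T hmA hμA hmB hμB j i‖ : ℝ) : ℂ) := by
    rw [hu, stepLp, map_sum, inner_sum, Complex.ofReal_sum]
    refine Finset.sum_congr rfl fun i _ => ?_
    rw [map_smul, inner_smul_right, ← hεm]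
    rfl
  have hle : ‖inner ℂ (indicatorConstLp 2 (hmB j) (hμB j) (1 : ℂ)) (T u)‖ ≤ μ.real (B j) := by
    rw [L2.inner_indicatorConstLp_one]
    have := norm_setIntegral_le_of_norm_le_const_ae' (μ := μ) (s := B j) (f := T u) (C := 1)
      (hμB j).lt_top (hTu.mono fun x hx _ => hx)
    simpa using this
  rw [hsum, Complex.norm_real, Real.norm_of_nonneg (by positivity)] at hle
  exact hle

variable [Fintype κ]

theorem inner_stepLp_apply_stepLp (c : ι → ℂ) (d : κ → ℂ) :
    inner ℂ (stepLp hmB hμB d) (T (stepLp hmA hμA c)) =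
      ∑ j, ∑ i, conj (d j) * c i * matrixEntry T hmA hμA hmB hμB j i := by
  simp only [stepLp, matrixEntry, map_sum, map_smul, sum_inner, inner_sum, inner_smul_left,
    inner_smul_right, Finset.mul_sum]
  rw [Finset.sum_comm]
  exact Finset.sum_congr rfl fun _ _ => Finset.sum_congr rfl fun _ _ => by ring

/-- Young's inequality for the sesquilinear form of `T`. -/
theorem IsSymmetricContraction.norm_inner_stepLp_le (hT : IsSymmetricContraction T)
    (hA : Pairwise fun i j => Disjoint (A i) (A j)) (hB : Pairwise fun i j => Disjoint (B i) (B j))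
    {r s : ℝ} (hrs : r.HolderConjugate s) (c : ι → ℂ) (d : κ → ℂ) :
    ‖inner ℂ (stepLp hmB hμB d) (T (stepLp hmA hμA c))‖ ≤
      (∫ x, ‖stepFun A c x‖ ^ r ∂μ) / r + (∫ x, ‖stepFun B d x‖ ^ s ∂μ) / s := by
  set τ := matrixEntry T hmA hμA hmB hμB with hτ
  have hr := hrs.pos
  have hs := hrs.symm.pos
  rw [inner_stepLp_apply_stepLp, integral_norm_rpow_stepFun hA hmA hμA c hr,
    integral_norm_rpow_stepFun hB hmB hμB d hs]
  calc ‖∑ j, ∑ i, conj (d j) * c i * τ j i‖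
      ≤ ∑ j, ∑ i, ‖conj (d j) * c i * τ j i‖ :=
        (norm_sum_le _ _).trans (Finset.sum_le_sum fun j _ => norm_sum_le _ _)
    _ ≤ ∑ j, ∑ i, (‖c i‖ ^ r / r * ‖τ j i‖ + ‖d j‖ ^ s / s * ‖τ j i‖) := by
        refine Finset.sum_le_sum fun j _ => Finset.sum_le_sum fun i _ => ?_
        rw [norm_mul, norm_mul, RCLike.norm_conj, ← add_mul, mul_comm ‖d j‖]
        gcongr
        exact Real.young_inequality_of_nonneg (norm_nonneg _) (norm_nonneg _) hrs
    _ = ∑ i, ‖c i‖ ^ r / r * ∑ j, ‖τ j i‖ + ∑ j, ‖d j‖ ^ s / s * ∑ i, ‖τ j i‖ := by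
        simp only [Finset.sum_add_distrib, Finset.mul_sum]
        rw [Finset.sum_comm]
    _ ≤ ∑ i, ‖c i‖ ^ r / r * μ.real (A i) + ∑ j, ‖d j‖ ^ s / s * μ.real (B j) := by
        gcongr with i _ j _
        · simp only [hτ, hT.norm_matrixEntry_comm hmA hμA hmB hμB]
          exact hT.sum_norm_matrixEntry_le hmB hμB hmA hμA hB i
        · exact hT.sum_norm_matrixEntry_le hmA hμA hmB hμB hA j
    _ = _ := by
        simp only [Finset.sum_div]
        congr 1 <;> exact Finset.sum_congr rfl fun i _ => by ring

theorem inner_stepLp_stepLp (hA : Pairwise fun i j => Disjoint (A i) (A j)) (c d : ι → ℂ) :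
    inner ℂ (stepLp hmA hμA d) (stepLp hmA hμA c) = ∑ i, c i * conj (d i) * μ.real (A i) := by
  rw [L2.inner_def]
  have h1 : ∀ᵐ x ∂μ, inner ℂ (stepLp hmA hμA d x) (stepLp hmA hμA c x) =
      stepFun A (fun i => c i * conj (d i)) x := by
    filter_upwards [coeFn_stepLp hmA hμA c, coeFn_stepLp hmA hμA d] with x hc hd
    rw [hc, hd, RCLike.inner_apply]
    rcases stepFun_eq_or hA x with ⟨i, hi⟩ | h
    · rw [hi, hi, hi]
    · rw [h, h, h]; simp
  rw [integral_congr_ae h1]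
  simp only [stepFun]
  rw [integral_finsetSum]
  · refine Finset.sum_congr rfl fun i _ => ?_
    rw [integral_indicator_const _ (hmA i), Complex.real_smul, mul_comm]
  · intro i _
    exact (integrable_indicator_iff (hmA i)).2 (integrableOn_const (hμA i))

/-- On step functions the form `⟪F_p f, f - T f⟫` is, thanks to the symmetry of `T`, a combination
with nonnegative coefficients of numbers `‖c i‖ ^ p` and of numbers
`(z - w) conj (F_p z - F_p w)`. -/
theorem IsSymmetricContraction.inner_dualityMap_stepLp_mem (hT : IsSymmetricContraction T)
    (hA : Pairwise fun i j => Disjoint (A i) (A j)) {p : ℝ} (hp : 1 < p) (c : ι → ℂ) :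
    inner ℂ (stepLp hmA hμA (dualityMap p ∘ c)) (stepLp hmA hμA c - T (stepLp hmA hμA c)) ∈
      closedSector (Real.arcsin |1 - 2 / p|) := by
  set φ := Real.arcsin |1 - 2 / p| with hφ
  have h₀ : 0 ≤ φ := Real.arcsin_nonneg.2 (abs_nonneg _)
  have h₁ : φ ≤ Real.pi / 2 := Real.arcsin_le_pi_div_two _
  set τ := matrixEntry T hmA hμA hmA hμA with hτ
  set F := dualityMap p with hF
  choose ε hε hετ using fun j i => Complex.exists_unit_mul_eq_norm (τ j i)
  have hετ' : ∀ j i, τ j i = conj (ε j i) * ‖τ j i‖ := by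
    intro j i
    rw [← hετ, ← mul_assoc, Complex.conj_mul', hε]; simp
  -- Symmetrize the double sum; each term is then a multiple of the pointwise expression.
  have key : inner ℂ (stepLp hmA hμA (F ∘ c)) (stepLp hmA hμA c - T (stepLp hmA hμA c)) =
      ∑ i, ((‖c i‖ ^ p * (μ.real (A i) - ∑ j, ‖τ i j‖) : ℝ) : ℂ) +
      ∑ j, ∑ i, ((‖τ j i‖ / 2 : ℝ) : ℂ) *
        ((conj (ε j i) * c i - c j) * conj (F (conj (ε j i) * c i) - F (c j))) := by
    have hterm : ∀ j i, ((‖τ j i‖ / 2 : ℝ) : ℂ) *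
        ((conj (ε j i) * c i - c j) * conj (F (conj (ε j i) * c i) - F (c j))) =
        (‖τ j i‖ * (‖c i‖ ^ p : ℝ) / 2 + ‖τ j i‖ * (‖c j‖ ^ p : ℝ) / 2) -
          (conj (F (c j)) * c i * τ j i / 2 + conj (F (c i)) * c j * τ i j / 2) := by
      intro j i
      have h1 : τ i j = ε j i * ‖τ j i‖ := by
        rw [hτ, ← hT.conj_matrixEntry hmA hμA hmA hμA, ← hτ]
        nth_rewrite 1 [hετ' j i]
        simp
      have hn : conj (ε j i) * ε j i = 1 := by rw [Complex.conj_mul', hε]; simp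
      rw [h1, hF, dualityMap_mul_of_norm_eq_one p (by rw [RCLike.norm_conj, hε]),
        ← mul_conj_dualityMap hp, ← mul_conj_dualityMap hp]
      nth_rewrite 4 [hετ' j i]
      simp only [map_sub, map_mul, Complex.conj_conj]
      push_cast
      linear_combination (‖τ j i‖ / 2 : ℂ) * c i * conj (dualityMap p (c i)) * hn
    simp only [hterm]
    rw [inner_sub_right, inner_stepLp_stepLp hmA hμA hA, inner_stepLp_apply_stepLp]
    simp only [Finset.sum_sub_distrib, Finset.sum_add_distrib, Function.comp]
    rw [Finset.sum_comm (f := fun j i => conj (F (c i)) * c j * τ i j / 2),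
      Finset.sum_comm (f := fun j i => (‖τ j i‖ : ℂ) * (‖c i‖ ^ p : ℝ) / 2)]
    have hn : ∀ i j, ‖τ i j‖ = ‖τ j i‖ := fun i j =>
      hT.norm_matrixEntry_comm hmA hμA hmA hμA j i
    have e1 : ∀ i, ((‖c i‖ ^ p * (μ.real (A i) - ∑ j, ‖τ i j‖) : ℝ) : ℂ) =
        c i * conj (F (c i)) * μ.real (A i) - ∑ j, (‖τ i j‖ : ℂ) * (‖c i‖ ^ p : ℝ) := by
      intro i
      rw [hF, mul_conj_dualityMap hp, ← Finset.sum_mul]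
      push_cast
      ring
    simp only [e1, Finset.sum_sub_distrib, hn]
    -- Halving both double sums aligns them with the symmetrized right-hand side.
    have e2 : ∀ x : ι → ι → ℂ, ∑ i, ∑ j, x i j = ∑ i, ∑ j, x i j / 2 + ∑ i, ∑ j, x i j / 2 := by
      intro x
      simp only [← Finset.sum_add_distrib, add_halves]
    rw [e2 (fun j i => conj (F (c j)) * c i * τ j i),
      e2 (fun i j => (‖τ i j‖ : ℂ) * (‖c i‖ ^ p : ℝ))]
    ring
  rw [key]
  refine add_mem_closedSector h₀ h₁ (sum_mem_closedSector h₀ h₁ _ fun i _ => ?_)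
    (sum_mem_closedSector h₀ h₁ _ fun j _ => sum_mem_closedSector h₀ h₁ _ fun i _ => ?_)
  · refine ofReal_mem_closedSector h₀ h₁ (mul_nonneg (by positivity) (sub_nonneg.2 ?_))
    exact hT.sum_norm_matrixEntry_le hmA hμA hmA hμA hA i
  · exact smul_mem_closedSector h₀ h₁ (sub_mul_conj_dualityMap_sub_mem hp _ _) (by positivity)

end Matrix

/-! ### Contractivity for all `L^r` norms -/

section Approximation

variable {Ω : Type*} [MeasurableSpace Ω] {μ : Measure Ω}

theorem exists_simpleFunc_approx (μ : Measure Ω) {f : Ω → ℂ} (hf : Measurable f) :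
    ∃ s : ℕ → SimpleFunc Ω ℂ, (∀ x, Tendsto (fun n => s n x) atTop (𝓝 (f x))) ∧
      (∀ n x, ‖s n x‖ ≤ 2 * ‖f x‖) ∧ (∀ q, MemLp f q μ → ∀ n, MemLp (s n) q μ) ∧
      ∀ q, q ≠ ∞ → MemLp f q μ → Tendsto (fun n => eLpNorm (⇑(s n) - f) q μ) atTop (𝓝 0) := by
  set s : ℕ → SimpleFunc Ω ℂ := SimpleFunc.approxOn f hf Set.univ 0 (Set.mem_univ _) with hs
  have hb : ∀ n x, ‖s n x‖ ≤ 2 * ‖f x‖ := fun n x =>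
    (SimpleFunc.norm_approxOn_zero_le hf (Set.mem_univ _) x n).trans_eq (two_mul _).symm
  refine ⟨s, fun x => SimpleFunc.tendsto_approxOn hf _ (by simp), hb, fun q hq n => ?_,
    fun q hq hfq => ?_⟩
  · exact hq.of_le_mul (s n).aestronglyMeasurable (Eventually.of_forall (hb n))
  · refine SimpleFunc.tendsto_approxOn_Lp_eLpNorm hf _ hq (by simp) ?_
    simpa using hfq.eLpNorm_lt_top

theorem integrable_norm_rpow_of_memLp {f : Ω → ℂ} {r : ℝ} (hr : 0 < r)
    (hf : MemLp f (ENNReal.ofReal r) μ) : Integrable (fun x => ‖f x‖ ^ r) μ := by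
  have := hf.integrable_norm_rpow (by simpa using hr) ENNReal.ofReal_ne_top
  rwa [ENNReal.toReal_ofReal hr.le] at this

theorem tendsto_integral_norm_rpow {f : Ω → ℂ} {r : ℝ} (hr : 0 < r)
    (hf : MemLp f (ENNReal.ofReal r) μ) {s : ℕ → SimpleFunc Ω ℂ}
    (hlim : ∀ x, Tendsto (fun n => s n x) atTop (𝓝 (f x))) (hb : ∀ n x, ‖s n x‖ ≤ 2 * ‖f x‖) :
    Tendsto (fun n => ∫ x, ‖s n x‖ ^ r ∂μ) atTop (𝓝 (∫ x, ‖f x‖ ^ r ∂μ)) := by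
  refine tendsto_integral_of_dominated_convergence (fun x => 2 ^ r * ‖f x‖ ^ r)
    (fun n => ?_) ((integrable_norm_rpow_of_memLp hr hf).const_mul _) (fun n => ?_) ?_
  · exact (((s n).measurable.norm).pow_const r).aestronglyMeasurable
  · refine Eventually.of_forall fun x => ?_
    rw [Real.norm_of_nonneg (by positivity), ← Real.mul_rpow zero_le_two (norm_nonneg _)]
    exact Real.rpow_le_rpow (norm_nonneg _) (hb n x) hr.le
  · exact Eventually.of_forall fun x => (hlim x).norm.rpow_const (Or.inr hr.le)

theorem eLpNorm_ofReal_eq {f : Ω → ℂ} {r : ℝ} (hr : 0 < r) (hf : MemLp f (ENNReal.ofReal r) μ) :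
    eLpNorm f (ENNReal.ofReal r) μ = ENNReal.ofReal ((∫ x, ‖f x‖ ^ r ∂μ) ^ r⁻¹) := by
  rw [hf.eLpNorm_eq_integral_rpow_norm (by simpa using hr) ENNReal.ofReal_ne_top,
    ENNReal.toReal_ofReal hr.le]

end Approximation

section Contraction

variable {Ω : Type*} [MeasurableSpace Ω] {μ : Measure Ω} {T : Lp ℂ 2 μ →L[ℂ] Lp ℂ 2 μ}

namespace IsSymmetricContraction

theorem norm_inner_le_of_simpleFunc (hT : IsSymmetricContraction T) {r s : ℝ}
    (hrs : r.HolderConjugate s) {f g : SimpleFunc Ω ℂ} (hf : MemLp f 2 μ) (hg : MemLp g 2 μ) :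
    ‖inner ℂ (hg.toLp g) (T (hf.toLp f))‖ ≤
      (∫ x, ‖f x‖ ^ r ∂μ) / r + (∫ x, ‖g x‖ ^ s ∂μ) / s := by
  obtain ⟨_, A, c, hA, hmA, hμA, hfA⟩ := exists_stepFun_eq two_ne_zero ENNReal.ofNat_ne_top f hf
  obtain ⟨_, B, d, hB, hmB, hμB, hgB⟩ := exists_stepFun_eq two_ne_zero ENNReal.ofNat_ne_top g hg
  have h1 : hf.toLp f = stepLp hmA hμA c := Lp.ext <| hf.coeFn_toLp.trans <|
    (EventuallyEq.of_eq (funext hfA)).trans (coeFn_stepLp hmA hμA c).symm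
  have h2 : hg.toLp g = stepLp hmB hμB d := Lp.ext <| hg.coeFn_toLp.trans <|
    (EventuallyEq.of_eq (funext hgB)).trans (coeFn_stepLp hmB hμB d).symm
  rw [h1, h2]
  simp only [hfA, hgB]
  exact hT.norm_inner_stepLp_le hmA hμA hmB hμB hA hB hrs c d

/-- Young's inequality for the form of `T` on `L² ∩ L^r` and `L² ∩ L^s`. -/
theorem norm_inner_le (hT : IsSymmetricContraction T) {r s : ℝ} (hrs : r.HolderConjugate s)
    (f g : Lp ℂ 2 μ) (hf : MemLp f (ENNReal.ofReal r) μ) (hg : MemLp g (ENNReal.ofReal s) μ) :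
    ‖inner ℂ g (T f)‖ ≤ (∫ x, ‖f x‖ ^ r ∂μ) / r + (∫ x, ‖g x‖ ^ s ∂μ) / s := by
  obtain ⟨u, hu, hub, hum, hul⟩ := exists_simpleFunc_approx μ (Lp.stronglyMeasurable f).measurable
  obtain ⟨v, hv, hvb, hvm, hvl⟩ := exists_simpleFunc_approx μ (Lp.stronglyMeasurable g).measurable
  have hconv : ∀ (f : Lp ℂ 2 μ) (u : ℕ → SimpleFunc Ω ℂ) (hu : ∀ n, MemLp (u n) 2 μ),
      Tendsto (fun n => eLpNorm (⇑(u n) - ⇑f) 2 μ) atTop (𝓝 0) →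
      Tendsto (fun n => (hu n).toLp (u n)) atTop (𝓝 f) := by
    intro f u hu h
    rw [Lp.tendsto_Lp_iff_tendsto_eLpNorm']
    refine h.congr fun n => eLpNorm_congr_ae ?_
    exact (hu n).coeFn_toLp.symm.sub (EventuallyEq.refl _ _)
  have hU := hconv f u (hum 2 (Lp.memLp f)) (hul 2 ENNReal.ofNat_ne_top (Lp.memLp f))
  have hV := hconv g v (hvm 2 (Lp.memLp g)) (hvl 2 ENNReal.ofNat_ne_top (Lp.memLp g))
  refine le_of_tendsto_of_tendsto'
    (hV.inner ((T.continuous.tendsto f).comp hU)).norm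
    (((tendsto_integral_norm_rpow hrs.pos hf hu hub).div_const r).add
      ((tendsto_integral_norm_rpow hrs.symm.pos hg hv hvb).div_const s)) fun n => ?_
  exact hT.norm_inner_le_of_simpleFunc hrs (hum 2 (Lp.memLp f) n) (hvm 2 (Lp.memLp g) n)

/-- A symmetric `L^∞`-contraction is a contraction for every `L^r` norm: test `T f` against
truncations of its image under the duality map. -/
theorem eLpNorm_apply_le (hT : IsSymmetricContraction T) {r : ℝ} (hr : 1 < r)
    (f : Lp ℂ 2 μ) (hf : MemLp f (ENNReal.ofReal r) μ) :
    eLpNorm (T f) (ENNReal.ofReal r) μ ≤ eLpNorm f (ENNReal.ofReal r) μ := by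
  have hr0 : 0 < r := by linarith
  set s := r.conjExponent with hs
  have hrs : r.HolderConjugate s := Real.HolderConjugate.conjExponent hr
  set u : Ω → ℂ := ⇑(T f) with hu
  have hum : Measurable u := (Lp.stronglyMeasurable (T f)).measurable
  -- On `D n` both `T f` and its image under the duality map are bounded, and `D n` has finite
  -- measure; this makes the test function `G` below admissible.
  set D : ℕ → Set Ω := fun n => {x | ((n : ℝ) + 1)⁻¹ ≤ ‖u x‖ ∧ ‖u x‖ ≤ n} with hD
  have hDm : ∀ n, MeasurableSet (D n) := fun n =>
    (measurableSet_le measurable_const hum.norm).inter (measurableSet_le hum.norm measurable_const)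
  have hDμ : ∀ n, μ (D n) < ∞ := by
    intro n
    have h1 := (Lp.memLp (T f)).meas_ge_lt_top two_ne_zero ENNReal.ofNat_ne_top
      (ε := ((n : ℝ≥0) + 1)⁻¹) (by positivity)
    refine (measure_mono fun x hx => ?_).trans_lt h1
    have := hx.1
    rw [Set.mem_ofPred_eq, ← NNReal.coe_le_coe]
    simpa using this
  have hmem : ∀ (F : ℂ → ℂ), Continuous F → ∀ (n : ℕ) (q : ℝ≥0∞),
      MemLp ((D n).indicator (F ∘ u)) q μ := by
    intro F hF n q
    rw [memLp_indicator_iff_restrict (hDm n)]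
    have : IsFiniteMeasure (μ.restrict (D n)) := ⟨by simpa using hDμ n⟩
    obtain ⟨C, hC⟩ := (isCompact_closedBall (0 : ℂ) n).exists_bound_of_continuousOn hF.continuousOn
    refine MemLp.of_bound (hF.measurable.comp hum).aestronglyMeasurable C ?_
    rw [ae_restrict_iff' (hDm n)]
    exact Eventually.of_forall fun x hx => hC _ (mem_closedBall_zero_iff.2 hx.2)
  have hbound : ∀ n, eLpNorm ((D n).indicator u) (ENNReal.ofReal r) μ ≤
      eLpNorm f (ENNReal.ofReal r) μ := by
    intro n
    have hw : MemLp ((D n).indicator u) (ENNReal.ofReal r) μ := hmem id continuous_id n _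
    set G : Ω → ℂ := (D n).indicator (dualityMap r ∘ u) with hG
    have hg : ∀ q, MemLp G q μ := hmem _ (continuous_dualityMap hr) n
    set g : Lp ℂ 2 μ := (hg 2).toLp G with hgdef
    have hgG : g =ᵐ[μ] G := (hg 2).coeFn_toLp
    set I := ∫ x, ‖(D n).indicator u x‖ ^ r ∂μ with hI
    have hI0 : 0 ≤ I := integral_nonneg fun x => by positivity
    have h1 : inner ℂ g (T f) = (I : ℂ) := by
      rw [L2.inner_def, hI, ← integral_complex_ofReal]
      refine integral_congr_ae ?_
      filter_upwards [hgG] with x hx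
      rw [hx, RCLike.inner_apply]
      change u x * _ = _
      by_cases hxD : x ∈ D n
      · simp only [hG, Set.indicator_of_mem hxD, Function.comp, mul_conj_dualityMap hr]
      · simp [hG, Set.indicator_of_notMem hxD, Real.zero_rpow hr0.ne']
    have h2 : ∫ x, ‖g x‖ ^ s ∂μ = I := by
      refine integral_congr_ae ?_
      filter_upwards [hgG] with x hx
      rw [hx]
      by_cases hxD : x ∈ D n
      · simp only [hG, Set.indicator_of_mem hxD, Function.comp, norm_dualityMap hr]
        rw [← Real.rpow_mul (norm_nonneg _), hrs.sub_one_mul_conj]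
      · simp [hG, Set.indicator_of_notMem hxD, Real.zero_rpow hr0.ne',
          Real.zero_rpow hrs.symm.pos.ne']
    have h3 := hT.norm_inner_le hrs f g hf ((hg _).ae_eq hgG.symm)
    rw [h1, h2, Complex.norm_real, Real.norm_of_nonneg hI0] at h3
    -- Young's inequality reads `I ≤ ‖f‖ᵣʳ / r + I / s`.
    have h4 : I ≤ ∫ x, ‖f x‖ ^ r ∂μ := by
      have h5 : I / r + I / s = I := by
        rw [div_eq_mul_inv, div_eq_mul_inv, ← mul_add, hrs.inv_add_inv_eq_one, mul_one]
      exact (div_le_div_iff_of_pos_right hr0).1 (by linarith)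
    rw [eLpNorm_ofReal_eq hr0 hw, eLpNorm_ofReal_eq hr0 hf]
    exact ENNReal.ofReal_le_ofReal (Real.rpow_le_rpow hI0 h4 (by positivity))
  have hlim : ∀ x, Tendsto (fun n => (D n).indicator u x) atTop (𝓝 (u x)) := by
    intro x
    by_cases hx : u x = 0
    · have : ∀ n, (D n).indicator u x = u x := fun n => by
        rw [hx]; exact Set.indicator_apply_eq_zero.2 fun _ => hx
      simp only [this]
      exact tendsto_const_nhds
    · refine tendsto_const_nhds.congr' ?_
      have hpos : 0 < ‖u x‖ := norm_pos_iff.2 hx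
      have h1 : ∀ᶠ n : ℕ in atTop, ((n : ℝ) + 1)⁻¹ < ‖u x‖ := by
        have := tendsto_one_div_add_atTop_nhds_zero_nat (𝕜 := ℝ)
        simp only [one_div] at this
        exact this.eventually (gt_mem_nhds hpos)
      have h2 : ∀ᶠ n : ℕ in atTop, ‖u x‖ ≤ n :=
        tendsto_natCast_atTop_atTop.eventually_ge_atTop _
      filter_upwards [h1, h2] with n hn1 hn2
      exact (Set.indicator_of_mem (show x ∈ D n from ⟨hn1.le, hn2⟩) u).symm
  refine (Lp.eLpNorm_lim_le_liminf_eLpNorm (fun n => (hum.indicator (hDm n)).aestronglyMeasurable)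
    u (Eventually.of_forall hlim)).trans ?_
  refine liminf_le_of_le (by isBoundedDefault) fun b hb => ?_
  obtain ⟨n, hn⟩ := hb.exists
  exact hn.trans (hbound n)

theorem memLp_apply (hT : IsSymmetricContraction T) {r : ℝ} (hr : 1 < r)
    (f : Lp ℂ 2 μ) (hf : MemLp f (ENNReal.ofReal r) μ) : MemLp (T f) (ENNReal.ofReal r) μ :=
  ⟨Lp.aestronglyMeasurable _, (hT.eLpNorm_apply_le hr f hf).trans_lt hf.eLpNorm_lt_top⟩

end IsSymmetricContraction

end Contraction

/-! ### The realisation on `L^p` -/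

theorem one_lt_toReal {p : ℝ≥0∞} (h1 : 1 < p) (hp : p ≠ ∞) : 1 < p.toReal := by
  rwa [← ENNReal.toReal_one, ENNReal.toReal_lt_toReal ENNReal.one_ne_top hp]

theorem LinearMap.exists_continuousLinearMap_of_denseRange {V F : Type*} [AddCommGroup V]
    [Module ℂ V] [NormedAddCommGroup F] [NormedSpace ℂ F] [CompleteSpace F] {e L : V →ₗ[ℂ] F}
    (he : DenseRange e) (hL : ∀ f, ‖L f‖ ≤ ‖e f‖) : ∃ S : F →L[ℂ] F, ∀ f, S (e f) = L f :=
  ⟨L.extendOfNorm e, fun f => LinearMap.extendOfNorm_eq he ⟨1, by simpa using hL⟩ f⟩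

section Realisation

variable {Ω : Type*} [MeasurableSpace Ω] {μ : Measure Ω} {p : ℝ≥0∞}

variable (μ p) in
/-- The space `L² ∩ L^p` as a subspace of `L²`. -/
def lpInter : Submodule ℂ (Lp ℂ 2 μ) where
  carrier := {f | MemLp f p μ}
  zero_mem' := MemLp.ae_eq (Lp.coeFn_zero ℂ 2 μ).symm MemLp.zero
  add_mem' := fun {f g} hf hg => (MemLp.add hf hg).ae_eq (Lp.coeFn_add f g).symm
  smul_mem' := fun c f hf => (MemLp.const_smul hf c).ae_eq (Lp.coeFn_smul c f).symm

theorem mem_lpInter {f : Lp ℂ 2 μ} : f ∈ lpInter μ p ↔ MemLp f p μ := Iff.rfl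

variable (μ p) in
/-- The inclusion of `L² ∩ L^p` in `L^p`. -/
noncomputable def lpInterToLp : lpInter μ p →ₗ[ℂ] Lp ℂ p μ where
  toFun f := MemLp.toLp _ (mem_lpInter.1 f.2)
  map_add' f g :=
    (MemLp.toLp_congr _ ((mem_lpInter.1 f.2).add (mem_lpInter.1 g.2)) (Lp.coeFn_add _ _)).trans
      (MemLp.toLp_add _ _)
  map_smul' c f :=
    (MemLp.toLp_congr _ ((mem_lpInter.1 f.2).const_smul c) (Lp.coeFn_smul _ _)).trans
      (MemLp.toLp_const_smul _ _)

theorem coeFn_lpInterToLp (f : lpInter μ p) : lpInterToLp μ p f =ᵐ[μ] (f : Lp ℂ 2 μ) :=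
  MemLp.coeFn_toLp (mem_lpInter.1 f.2)

theorem IsSymmetricContraction.eLpNorm_apply_le' {T : Lp ℂ 2 μ →L[ℂ] Lp ℂ 2 μ}
    (hT : IsSymmetricContraction T) (h1 : 1 < p) (hp : p ≠ ∞)
    {f : Lp ℂ 2 μ} (hf : MemLp f p μ) : eLpNorm (T f) p μ ≤ eLpNorm f p μ := by
  have := hT.eLpNorm_apply_le (one_lt_toReal h1 hp) f
  rw [ENNReal.ofReal_toReal hp] at this
  exact this hf

theorem norm_lpInterToLp (f : lpInter μ p) :
    ‖lpInterToLp μ p f‖ = (eLpNorm (f : Lp ℂ 2 μ) p μ).toReal := by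
  rw [Lp.norm_def, eLpNorm_congr_ae (coeFn_lpInterToLp f)]

theorem lpInterToLp_eq {f : lpInter μ p} {g : Lp ℂ p μ} (h : (f : Lp ℂ 2 μ) =ᵐ[μ] g) :
    lpInterToLp μ p f = g :=
  Lp.ext ((coeFn_lpInterToLp f).trans h)

theorem IsSymmetricContraction.apply_mem_lpInter {T : Lp ℂ 2 μ →L[ℂ] Lp ℂ 2 μ}
    (hT : IsSymmetricContraction T) (h1 : 1 < p) (hp : p ≠ ∞)
    {f : Lp ℂ 2 μ} (hf : f ∈ lpInter μ p) : T f ∈ lpInter μ p :=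
  ⟨Lp.aestronglyMeasurable _, (hT.eLpNorm_apply_le' h1 hp hf).trans_lt (MemLp.eLpNorm_lt_top hf)⟩

variable [Fact (1 ≤ p)]

/-- Every element of `L^p`, `p < ∞`, is a dominated limit of integrable simple functions. -/
theorem Lp.exists_simpleFunc_approx (hp : p ≠ ∞) (f : Lp ℂ p μ) :
    ∃ (u : ℕ → SimpleFunc Ω ℂ) (hu : ∀ n q, MemLp (u n) q μ),
      (∀ x, Tendsto (fun n => u n x) atTop (𝓝 (f x))) ∧ (∀ n x, ‖u n x‖ ≤ 2 * ‖f x‖) ∧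
      Tendsto (fun n => (hu n p).toLp (u n)) atTop (𝓝 f) := by
  have hp0 : p ≠ 0 := (zero_lt_one.trans_le (Fact.out : 1 ≤ p)).ne'
  obtain ⟨u, h1, h2, h3, h4⟩ := _root_.exists_simpleFunc_approx μ
    (Lp.stronglyMeasurable f).measurable
  have hu : ∀ n q, MemLp (u n) q μ := fun n q =>
    SimpleFunc.memLp_of_finite_measure_preimage q
      ((SimpleFunc.memLp_iff hp0 hp).1 (h3 p (Lp.memLp f) n))
  refine ⟨u, hu, h1, h2, ?_⟩
  rw [Lp.tendsto_Lp_iff_tendsto_eLpNorm']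
  refine (h4 p hp (Lp.memLp f)).congr fun n => eLpNorm_congr_ae ?_
  exact (hu n p).coeFn_toLp.symm.sub (EventuallyEq.refl _ _)

/-- `Tp` agrees with `T` on `L² ∩ L^p`. -/
def IsLpExtension (T : Lp ℂ 2 μ →L[ℂ] Lp ℂ 2 μ) (Tp : Lp ℂ p μ →L[ℂ] Lp ℂ p μ) : Prop :=
  ∀ (f : Lp ℂ 2 μ) (g : Lp ℂ p μ), f =ᵐ[μ] g → T f =ᵐ[μ] Tp g

theorem denseRange_lpInterToLp (hp : p ≠ ∞) : DenseRange (lpInterToLp μ p) := by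
  intro f
  obtain ⟨u, hu, -, -, hlim⟩ := Lp.exists_simpleFunc_approx hp f
  refine mem_closure_of_tendsto hlim (Eventually.of_forall fun n => ?_)
  have h := (hu n 2).coeFn_toLp
  exact ⟨⟨(hu n 2).toLp (u n), (hu n p).ae_eq h.symm⟩,
    lpInterToLp_eq (h.trans (hu n p).coeFn_toLp.symm)⟩

variable {T : Lp ℂ 2 μ →L[ℂ] Lp ℂ 2 μ} {Tp : Lp ℂ p μ →L[ℂ] Lp ℂ p μ}

namespace IsSymmetricContraction

theorem exists_isLpExtension (hT : IsSymmetricContraction T) (h1 : 1 < p) (hp : p ≠ ∞) :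
    ∃ Tp : Lp ℂ p μ →L[ℂ] Lp ℂ p μ, IsLpExtension T Tp := by
  obtain ⟨S, hS⟩ := LinearMap.exists_continuousLinearMap_of_denseRange
    (e := lpInterToLp μ p)
    (L := lpInterToLp μ p ∘ₗ (T : Lp ℂ 2 μ →ₗ[ℂ] Lp ℂ 2 μ).restrict
      fun f hf => hT.apply_mem_lpInter h1 hp hf)
    (denseRange_lpInterToLp hp) fun f => by
      rw [LinearMap.comp_apply, norm_lpInterToLp, norm_lpInterToLp]
      exact ENNReal.toReal_mono (MemLp.eLpNorm_ne_top f.2) (hT.eLpNorm_apply_le' h1 hp f.2)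
  refine ⟨S, fun f g hfg => ?_⟩
  have hf : f ∈ lpInter μ p := (Lp.memLp g).ae_eq hfg.symm
  have hg : lpInterToLp μ p ⟨f, hf⟩ = g := lpInterToLp_eq hfg
  rw [← hg, hS, LinearMap.comp_apply]
  exact (coeFn_lpInterToLp (p := p) ⟨T f, hT.apply_mem_lpInter h1 hp hf⟩).symm

end IsSymmetricContraction

namespace IsLpExtension

theorem apply_lpInterToLp (h : IsLpExtension T Tp) (f : lpInter μ p) :
    T f =ᵐ[μ] Tp (lpInterToLp μ p f) :=
  h _ _ (coeFn_lpInterToLp f).symm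

theorem apply_mem (h : IsLpExtension T Tp) (f : lpInter μ p) : T f ∈ lpInter μ p :=
  (Lp.memLp _).ae_eq (h.apply_lpInterToLp f).symm

theorem lpInterToLp_apply (h : IsLpExtension T Tp) (f : lpInter μ p) :
    Tp (lpInterToLp μ p f) = lpInterToLp μ p ⟨T f, h.apply_mem f⟩ :=
  (lpInterToLp_eq (h.apply_lpInterToLp f)).symm

theorem unique {Tp' : Lp ℂ p μ →L[ℂ] Lp ℂ p μ} (hp : p ≠ ∞) (h : IsLpExtension T Tp)
    (h' : IsLpExtension T Tp') : Tp = Tp' := by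
  refine DFunLike.coe_injective ((denseRange_lpInterToLp hp).equalizer Tp.continuous
    Tp'.continuous (funext fun f => ?_))
  rw [Function.comp, Function.comp, h.lpInterToLp_apply, h'.lpInterToLp_apply]

theorem one : IsLpExtension (1 : Lp ℂ 2 μ →L[ℂ] Lp ℂ 2 μ) (1 : Lp ℂ p μ →L[ℂ] _) :=
  fun _ _ h => h

theorem mul {T' : Lp ℂ 2 μ →L[ℂ] Lp ℂ 2 μ} {Tp' : Lp ℂ p μ →L[ℂ] Lp ℂ p μ}
    (h : IsLpExtension T Tp) (h' : IsLpExtension T' Tp') : IsLpExtension (T * T') (Tp * Tp') :=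
  fun f g hfg => h _ _ (h' f g hfg)

theorem norm_le_one (hT : IsSymmetricContraction T) (h1 : 1 < p) (hp : p ≠ ∞)
    (h : IsLpExtension T Tp) : ‖Tp‖ ≤ 1 := by
  refine Tp.opNorm_le_bound zero_le_one fun f => ?_
  rw [one_mul]
  refine (denseRange_lpInterToLp hp).induction_on (p := fun f => ‖Tp f‖ ≤ ‖f‖) f
    (isClosed_le (by fun_prop) (by fun_prop)) fun f => ?_
  rw [h.lpInterToLp_apply, norm_lpInterToLp, norm_lpInterToLp]
  exact ENNReal.toReal_mono (MemLp.eLpNorm_ne_top f.2) (hT.eLpNorm_apply_le' h1 hp f.2)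

end IsLpExtension

end Realisation

/-! ### Strong continuity on `L^p` -/

section StrongContinuity

/-- Interpolation of powers: `ρ` is chosen such that `r` lies strictly between `2` and `ρ`, or
`ρ = r = 2`. -/
theorem exists_rpow_le_add {r : ℝ} (hr : 1 < r) : ∃ ρ : ℝ, 1 < ρ ∧ ∀ ε : ℝ, 0 < ε →
    ∃ C : ℝ, 0 ≤ C ∧ ∀ x : ℝ, 0 ≤ x → x ^ r ≤ ε * x ^ ρ + C * x ^ (2 : ℝ) := by
  rcases lt_trichotomy r 2 with h | rfl | h
  · refine ⟨(1 + r) / 2, by linarith, fun ε hε => ?_⟩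
    set η := ε ^ (r - (1 + r) / 2)⁻¹ with hη
    have hd : 0 < r - (1 + r) / 2 := by linarith
    have hη0 : 0 < η := Real.rpow_pos_of_pos hε _
    refine ⟨η ^ (r - 2), by positivity, fun x hx => ?_⟩
    rcases hx.eq_or_lt with rfl | hx
    · rw [Real.zero_rpow (by linarith)]; positivity
    rcases le_total x η with hxη | hxη
    · have h1 : x ^ (r - (1 + r) / 2) ≤ ε := by
        calc _ ≤ η ^ (r - (1 + r) / 2) := Real.rpow_le_rpow hx.le hxη hd.le
          _ = ε := by rw [hη, ← Real.rpow_mul hε.le, inv_mul_cancel₀ hd.ne', Real.rpow_one]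
      have h2 : x ^ r = x ^ (r - (1 + r) / 2) * x ^ ((1 + r) / 2) := by
        rw [← Real.rpow_add hx, sub_add_cancel]
      rw [h2]
      have : 0 ≤ η ^ (r - 2) * x ^ (2 : ℝ) := by positivity
      have := mul_le_mul_of_nonneg_right h1 (Real.rpow_nonneg hx.le ((1 + r) / 2))
      linarith
    · have h1 : x ^ (r - 2) ≤ η ^ (r - 2) :=
        Real.rpow_le_rpow_of_nonpos hη0 hxη (by linarith)
      have h2 : x ^ r = x ^ (r - 2) * x ^ (2 : ℝ) := by
        rw [← Real.rpow_add hx, sub_add_cancel]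
      rw [h2]
      have : 0 ≤ ε * x ^ ((1 + r) / 2) := by positivity
      have := mul_le_mul_of_nonneg_right h1 (Real.rpow_nonneg hx.le 2)
      linarith
  · refine ⟨2, one_lt_two, fun ε hε => ⟨1, zero_le_one, fun x hx => ?_⟩⟩
    have : 0 ≤ ε * x ^ (2 : ℝ) := by positivity
    linarith
  · refine ⟨r + 1, by linarith, fun ε hε => ⟨ε⁻¹ ^ (r - 2), by positivity, fun x hx => ?_⟩⟩
    rcases hx.eq_or_lt with rfl | hx
    · rw [Real.zero_rpow (by linarith)]; positivity
    rcases le_total x ε⁻¹ with hxη | hxη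
    · have h1 : x ^ (r - 2) ≤ ε⁻¹ ^ (r - 2) := Real.rpow_le_rpow hx.le hxη (by linarith)
      have h2 : x ^ r = x ^ (r - 2) * x ^ (2 : ℝ) := by
        rw [← Real.rpow_add hx, sub_add_cancel]
      rw [h2]
      have : 0 ≤ ε * x ^ (r + 1) := by positivity
      have := mul_le_mul_of_nonneg_right h1 (Real.rpow_nonneg hx.le 2)
      linarith
    · have h1 : 1 ≤ ε * x := by
        rw [inv_le_iff_one_le_mul₀' hε] at hxη
        exact hxη
      rw [Real.rpow_add_one hx.ne']
      have h2 : 0 ≤ ε⁻¹ ^ (r - 2) * x ^ (2 : ℝ) := by positivity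
      have := mul_le_mul_of_nonneg_left h1 (Real.rpow_nonneg hx.le r)
      linarith

variable {Ω : Type*} [MeasurableSpace Ω] {μ : Measure Ω}

theorem integral_norm_rpow_eq {f : Ω → ℂ} {r : ℝ} (hr : 0 < r)
    (hf : MemLp f (ENNReal.ofReal r) μ) :
    ∫ x, ‖f x‖ ^ r ∂μ = (eLpNorm f (ENNReal.ofReal r) μ).toReal ^ r := by
  have h0 : 0 ≤ ∫ x, ‖f x‖ ^ r ∂μ := integral_nonneg fun x => by positivity
  rw [eLpNorm_ofReal_eq hr hf, ENNReal.toReal_ofReal (by positivity), ← Real.rpow_mul h0,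
    inv_mul_cancel₀ hr.ne', Real.rpow_one]

variable {p : ℝ≥0∞}

theorem integral_norm_rpow_eq_norm (h1 : 1 < p) (hp : p ≠ ∞) (f : Lp ℂ p μ) :
    ∫ x, ‖f x‖ ^ p.toReal ∂μ = ‖f‖ ^ p.toReal := by
  have h : MemLp f (ENNReal.ofReal p.toReal) μ := by
    rw [ENNReal.ofReal_toReal hp]
    exact Lp.memLp f
  have hr := one_lt_toReal h1 hp
  rw [integral_norm_rpow_eq (by linarith) h, ENNReal.ofReal_toReal hp, Lp.norm_def]

variable [Fact (1 ≤ p)]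

/-- Strong continuity passes from `L²` to `L^p`. For integrable simple `f` the differences
`T s f - T t f` tend to `0` in `L²` and stay bounded in `L^ρ`, where `p` lies between `2` and `ρ`;
the general case follows by density and contractivity. -/
theorem continuous_of_isLpExtension {X : Type*} [TopologicalSpace X]
    {T : X → Lp ℂ 2 μ →L[ℂ] Lp ℂ 2 μ} {Tp : X → Lp ℂ p μ →L[ℂ] Lp ℂ p μ}
    (hT : ∀ t, IsSymmetricContraction (T t)) (hcont : ∀ f, Continuous fun t => T t f)
    (h1 : 1 < p) (hp : p ≠ ∞) (h : ∀ t, IsLpExtension (T t) (Tp t)) (f : Lp ℂ p μ) :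
    Continuous fun t => Tp t f := by
  set r := p.toReal with hr
  have hr1 : 1 < r := one_lt_toReal h1 hp
  have hr0 : 0 < r := by linarith
  have hpr : ENNReal.ofReal r = p := ENNReal.ofReal_toReal hp
  have hsimple : ∀ (u : SimpleFunc Ω ℂ) (hu : ∀ q, MemLp u q μ),
      Continuous fun t => Tp t ((hu p).toLp u) := by
    intro u hu
    obtain ⟨ρ, hρ1, hρ⟩ := exists_rpow_le_add hr1
    have hρ0 : 0 < ρ := by linarith
    rw [continuous_iff_continuousAt]
    intro t
    set f₂ := (hu 2).toLp u with hf₂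
    have hf₂u : f₂ =ᵐ[μ] u := (hu 2).coeFn_toLp
    set v : X → Lp ℂ 2 μ := fun s => T s f₂ - T t f₂ with hv
    have hvlim : Tendsto (fun s => ‖v s‖ ^ (2 : ℝ)) (𝓝 t) (𝓝 0) := by
      have : Continuous fun s => ‖v s‖ ^ (2 : ℝ) :=
        ((hcont f₂).sub continuous_const).norm.rpow_const fun _ => Or.inr zero_le_two
      have := this.tendsto t
      simpa [hv] using this
    have hmem : ∀ q : ℝ, 1 < q → MemLp f₂ (ENNReal.ofReal q) μ := fun q _ =>
      (hu _).ae_eq hf₂u.symm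
    have hvmem : ∀ s, ∀ q : ℝ, 1 < q → MemLp (v s) (ENNReal.ofReal q) μ := fun s q hq =>
      (((hT s).memLp_apply hq f₂ (hmem q hq)).sub ((hT t).memLp_apply hq f₂ (hmem q hq))).ae_eq
        (Lp.coeFn_sub _ _).symm
    set K : ℝ := (2 * eLpNorm f₂ (ENNReal.ofReal ρ) μ).toReal ^ ρ with hK
    have hK0 : 0 ≤ K := by positivity
    have hvK : ∀ s, ∫ x, ‖v s x‖ ^ ρ ∂μ ≤ K := by
      intro s
      rw [integral_norm_rpow_eq hρ0 (hvmem s ρ hρ1), hK]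
      refine Real.rpow_le_rpow ENNReal.toReal_nonneg (ENNReal.toReal_mono
        (ENNReal.mul_ne_top ENNReal.ofNat_ne_top (hmem ρ hρ1).eLpNorm_ne_top) ?_) hρ0.le
      rw [eLpNorm_congr_ae (Lp.coeFn_sub _ _), two_mul]
      refine (eLpNorm_sub_le (Lp.aestronglyMeasurable _) (Lp.aestronglyMeasurable _) ?_).trans
        (add_le_add ((hT s).eLpNorm_apply_le hρ1 f₂ (hmem ρ hρ1))
          ((hT t).eLpNorm_apply_le hρ1 f₂ (hmem ρ hρ1)))
      simpa using hρ1.le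
    have hTpv : ∀ s, Tp s ((hu p).toLp u) - Tp t ((hu p).toLp u) =ᵐ[μ] v s := by
      intro s
      have hfu : f₂ =ᵐ[μ] (hu p).toLp u := hf₂u.trans (hu p).coeFn_toLp.symm
      filter_upwards [Lp.coeFn_sub (Tp s ((hu p).toLp u)) (Tp t ((hu p).toLp u)),
        Lp.coeFn_sub (T s f₂) (T t f₂), h s _ _ hfu, h t _ _ hfu] with x e1 e2 e3 e4
      rw [e1, e2, Pi.sub_apply, Pi.sub_apply, e3, e4]
    have hnorm : ∀ s, ‖Tp s ((hu p).toLp u) - Tp t ((hu p).toLp u)‖ ^ r =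
        ∫ x, ‖v s x‖ ^ r ∂μ := by
      intro s
      rw [← integral_norm_rpow_eq_norm h1 hp]
      refine integral_congr_ae ?_
      filter_upwards [hTpv s] with x hx
      rw [hx]
    have hv2 : ∀ s, ∫ x, ‖v s x‖ ^ (2 : ℝ) ∂μ = ‖v s‖ ^ (2 : ℝ) := by
      intro s
      have := integral_norm_rpow_eq_norm ENNReal.one_lt_two ENNReal.ofNat_ne_top (v s)
      simpa using this
    have hmain : Tendsto (fun s => ‖Tp s ((hu p).toLp u) - Tp t ((hu p).toLp u)‖ ^ r) (𝓝 t)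
        (𝓝 0) := by
      rw [Metric.tendsto_nhds]
      intro ε hε
      obtain ⟨C, hC0, hC⟩ := hρ (ε / 2 / (K + 1)) (by positivity)
      have hev : ∀ᶠ s in 𝓝 t, C * ‖v s‖ ^ (2 : ℝ) < ε / 2 := by
        have := hvlim.const_mul C
        rw [mul_zero] at this
        exact this.eventually (gt_mem_nhds (by linarith))
      filter_upwards [hev] with s hs
      rw [Real.dist_0_eq_abs, abs_of_nonneg (by positivity), hnorm]
      have hi1 := integrable_norm_rpow_of_memLp hρ0 (hvmem s ρ hρ1)
      have hi2 := integrable_norm_rpow_of_memLp zero_lt_two (hvmem s 2 one_lt_two)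
      calc ∫ x, ‖v s x‖ ^ r ∂μ
          ≤ ∫ x, (ε / 2 / (K + 1) * ‖v s x‖ ^ ρ + C * ‖v s x‖ ^ (2 : ℝ)) ∂μ :=
            integral_mono (integrable_norm_rpow_of_memLp hr0 (hvmem s r hr1))
              ((hi1.const_mul _).add (hi2.const_mul _)) fun x => hC _ (norm_nonneg _)
        _ = ε / 2 / (K + 1) * ∫ x, ‖v s x‖ ^ ρ ∂μ + C * ‖v s‖ ^ (2 : ℝ) := by
            rw [integral_add (hi1.const_mul _) (hi2.const_mul _), integral_const_mul,
              integral_const_mul, hv2]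
        _ < ε / 2 + ε / 2 := by
            refine add_lt_add_of_le_of_lt ?_ hs
            calc _ ≤ ε / 2 / (K + 1) * (K + 1) := by
                  gcongr; linarith [hvK s]
              _ = ε / 2 := by field_simp
        _ = ε := add_halves ε
    rw [ContinuousAt, tendsto_iff_norm_sub_tendsto_zero]
    have := hmain.rpow_const (p := r⁻¹) (Or.inr (by positivity))
    rw [Real.zero_rpow (by positivity)] at this
    refine this.congr fun s => ?_
    rw [← Real.rpow_mul (norm_nonneg _), mul_inv_cancel₀ hr0.ne', Real.rpow_one]
  obtain ⟨u, hu, -, -, hlim⟩ := Lp.exists_simpleFunc_approx hp f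
  have hunif : TendstoUniformly (fun n t => Tp t ((hu n p).toLp (u n))) (fun t => Tp t f)
      atTop := by
    rw [Metric.tendstoUniformly_iff]
    intro ε hε
    filter_upwards [Metric.tendsto_nhds.1 hlim ε hε] with n hn t
    rw [dist_eq_norm, ← map_sub]
    refine (ContinuousLinearMap.le_of_opNorm_le _
      (IsLpExtension.norm_le_one (hT t) h1 hp (h t)) _).trans_lt ?_
    rwa [one_mul, ← dist_eq_norm, dist_comm]
  exact hunif.continuous (Frequently.of_forall fun n => hsimple (u n) (hu n))

end StrongContinuity

/-! ### The numerical range on `L^p` -/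

section NumericalRange

variable {Ω : Type*} [MeasurableSpace Ω] {μ : Measure Ω} {p : ℝ≥0∞}

theorem norm_dualityMap_rpow_conjExponent {r : ℝ} (hr : 1 < r) (z : ℂ) :
    ‖dualityMap r z‖ ^ r.conjExponent = ‖z‖ ^ r := by
  rw [norm_dualityMap hr, ← Real.rpow_mul (norm_nonneg _),
    (Real.HolderConjugate.conjExponent hr).sub_one_mul_conj]

theorem memLp_dualityMap (h1 : 1 < p) (hp : p ≠ ∞) (f : Lp ℂ p μ) :
    MemLp (fun x => dualityMap p.toReal (f x)) (ENNReal.ofReal p.toReal.conjExponent) μ := by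
  have hr := one_lt_toReal h1 hp
  have hs := (Real.HolderConjugate.conjExponent hr).symm.pos
  have hm : Measurable fun x => dualityMap p.toReal (f x) :=
    (continuous_dualityMap hr).measurable.comp (Lp.stronglyMeasurable f).measurable
  rw [← integrable_norm_rpow_iff hm.aestronglyMeasurable (by simpa using hs)
    ENNReal.ofReal_ne_top, ENNReal.toReal_ofReal hs.le]
  simp only [norm_dualityMap_rpow_conjExponent hr]
  exact (Lp.memLp f).integrable_norm_rpow (zero_lt_one.trans h1).ne' hp

variable [Fact (1 ≤ p)]

theorem norm_eq_integral_rpow (h1 : 1 < p) (hp : p ≠ ∞) (f : Lp ℂ p μ) :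
    ‖f‖ = (∫ x, ‖f x‖ ^ p.toReal ∂μ) ^ (1 / p.toReal) := by
  have hr := one_lt_toReal h1 hp
  rw [integral_norm_rpow_eq_norm h1 hp, ← Real.rpow_mul (norm_nonneg _), mul_one_div_cancel
    (by linarith), Real.rpow_one]

/-- Hölder's inequality for `g` and `F_p f`, where `‖F_p f‖` in the conjugate exponent is
`‖f‖ ^ (p - 1)`. -/
theorem holder_dualityMap (h1 : 1 < p) (hp : p ≠ ∞) (f g : Lp ℂ p μ) :
    Integrable (fun x => ‖g x‖ * ‖dualityMap p.toReal (f x)‖) μ ∧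
      ∫ x, ‖g x‖ * ‖dualityMap p.toReal (f x)‖ ∂μ ≤ ‖g‖ * ‖f‖ ^ (p.toReal - 1) := by
  have hr := one_lt_toReal h1 hp
  have hrs := Real.HolderConjugate.conjExponent hr
  have hg : MemLp g (ENNReal.ofReal p.toReal) μ := by
    rw [ENNReal.ofReal_toReal hp]
    exact Lp.memLp g
  have hf := memLp_dualityMap h1 hp f
  constructor
  · have : ENNReal.HolderTriple (ENNReal.ofReal p.toReal)
        (ENNReal.ofReal p.toReal.conjExponent) 1 := hrs.ennrealOfReal
    exact (memLp_one_iff_integrable.1 (hf.norm.mul hg.norm))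
  · refine (integral_mul_norm_le_Lp_mul_Lq hrs hg hf).trans_eq ?_
    simp only [norm_dualityMap_rpow_conjExponent hr]
    rw [← norm_eq_integral_rpow h1 hp g, integral_norm_rpow_eq_norm h1 hp,
      ← Real.rpow_mul (norm_nonneg _)]
    congr 2
    rw [one_div, ← hrs.one_sub_inv]
    field_simp

theorem integrable_mul_conj_dualityMap (h1 : 1 < p) (hp : p ≠ ∞) (f g : Lp ℂ p μ) :
    Integrable (fun x => g x * conj (dualityMap p.toReal (f x))) μ := by
  have hr := one_lt_toReal h1 hp
  refine (holder_dualityMap h1 hp f g).1.mono' ?_ (Eventually.of_forall fun x => ?_)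
  · have hm : Measurable fun x => dualityMap p.toReal (f x) :=
      (continuous_dualityMap hr).measurable.comp (Lp.stronglyMeasurable f).measurable
    exact (Lp.aestronglyMeasurable g).mul
      (RCLike.continuous_conj.measurable.comp hm).aestronglyMeasurable
  · rw [norm_mul, RCLike.norm_conj]

/-- The functional `g ↦ ∫ g conj (F_p f)` on `L^p`. -/
noncomputable def dualityFunctional (h1 : 1 < p) (hp : p ≠ ∞) (f : Lp ℂ p μ) : Lp ℂ p μ →L[ℂ] ℂ :=
  LinearMap.mkContinuous
    { toFun := fun g => ∫ x, g x * conj (dualityMap p.toReal (f x)) ∂μ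
      map_add' := fun g g' => by
        rw [← integral_add (integrable_mul_conj_dualityMap h1 hp f g)
          (integrable_mul_conj_dualityMap h1 hp f g')]
        refine integral_congr_ae ?_
        filter_upwards [Lp.coeFn_add g g'] with x hx
        rw [hx, Pi.add_apply, add_mul]
      map_smul' := fun c g => by
        rw [RingHom.id_apply, smul_eq_mul, ← integral_const_mul]
        refine integral_congr_ae ?_
        filter_upwards [Lp.coeFn_smul c g] with x hx
        rw [hx, Pi.smul_apply, smul_eq_mul, mul_assoc] } (‖f‖ ^ (p.toReal - 1)) fun g => by
    rw [mul_comm]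
    refine (norm_integral_le_integral_norm _).trans ?_
    simp only [norm_mul, RCLike.norm_conj]
    exact (holder_dualityMap h1 hp f g).2

theorem dualityFunctional_apply (h1 : 1 < p) (hp : p ≠ ∞) (f g : Lp ℂ p μ) :
    dualityFunctional h1 hp f g = ∫ x, g x * conj (dualityMap p.toReal (f x)) ∂μ := rfl

theorem norm_dualityFunctional_le (h1 : 1 < p) (hp : p ≠ ∞) (f : Lp ℂ p μ) :
    ‖dualityFunctional h1 hp f‖ ≤ ‖f‖ ^ (p.toReal - 1) :=
  LinearMap.mkContinuous_norm_le _ (by positivity) _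

theorem dualityFunctional_self (h1 : 1 < p) (hp : p ≠ ∞) (f : Lp ℂ p μ) :
    dualityFunctional h1 hp f f = ((‖f‖ ^ p.toReal : ℝ) : ℂ) := by
  rw [dualityFunctional_apply, ← integral_norm_rpow_eq_norm h1 hp, ← integral_complex_ofReal]
  simp only [mul_conj_dualityMap (one_lt_toReal h1 hp)]

variable {T : Lp ℂ 2 μ →L[ℂ] Lp ℂ 2 μ} {Tp : Lp ℂ p μ →L[ℂ] Lp ℂ p μ}

theorem dualityFunctional_sub_apply_mem_of_simpleFunc (hT : IsSymmetricContraction T)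
    (h1 : 1 < p) (hp : p ≠ ∞) (h : IsLpExtension T Tp) (u : SimpleFunc Ω ℂ)
    (hu : ∀ q, MemLp u q μ) :
    dualityFunctional h1 hp ((hu p).toLp u) ((hu p).toLp u - Tp ((hu p).toLp u)) ∈
      closedSector (Real.arcsin |1 - 2 / p.toReal|) := by
  obtain ⟨_, A, c, hA, hmA, hμA, huA⟩ := exists_stepFun_eq two_ne_zero ENNReal.ofNat_ne_top u (hu 2)
  have hstep : stepLp hmA hμA c =ᵐ[μ] u :=
    (coeFn_stepLp hmA hμA c).trans (EventuallyEq.of_eq (funext huA).symm)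
  have hup := (hu p).coeFn_toLp
  convert hT.inner_dualityMap_stepLp_mem hmA hμA hA (one_lt_toReal h1 hp) c using 1
  rw [L2.inner_def, dualityFunctional_apply]
  refine integral_congr_ae ?_
  filter_upwards [hup, hstep, h _ _ (hstep.trans hup.symm),
    coeFn_stepLp hmA hμA (dualityMap p.toReal ∘ c),
    Lp.coeFn_sub ((hu p).toLp u) (Tp ((hu p).toLp u)),
    Lp.coeFn_sub (stepLp hmA hμA c) (T (stepLp hmA hμA c))] with x e1 e2 e3 e4 e5 e6
  rw [RCLike.inner_apply, e5, e6, Pi.sub_apply, Pi.sub_apply, e3, e2, e1, e4,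
    ← map_stepFun hA (dualityMap_zero _), huA]

/-- The numerical range of `1 - T` on `L^p` lies in the sector of half-angle
`arcsin |1 - 2 / p|`. -/
theorem dualityFunctional_sub_apply_mem (hT : IsSymmetricContraction T)
    (h1 : 1 < p) (hp : p ≠ ∞) (h : IsLpExtension T Tp) (f : Lp ℂ p μ) :
    dualityFunctional h1 hp f (f - Tp f) ∈ closedSector (Real.arcsin |1 - 2 / p.toReal|) := by
  have hr := one_lt_toReal h1 hp
  obtain ⟨u, hu, hpt, hb, hlim⟩ := Lp.exists_simpleFunc_approx hp f
  set v : ℕ → Lp ℂ p μ := fun n => (hu n p).toLp (u n) with hv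
  set g := f - Tp f with hg
  refine (isClosed_closedSector (Real.arcsin_nonneg.2 (abs_nonneg _))
    (Real.arcsin_le_pi_div_two _)).mem_of_tendsto (b := atTop)
    (f := fun n => dualityFunctional h1 hp (v n) (v n - Tp (v n))) ?_
    (Eventually.of_forall fun n =>
      dualityFunctional_sub_apply_mem_of_simpleFunc hT h1 hp h (u n) (hu n))
  have hD : Tendsto (fun n => dualityFunctional h1 hp (v n) g) atTop
      (𝓝 (dualityFunctional h1 hp f g)) := by
    have he : ∀ n, dualityFunctional h1 hp (v n) g =
        ∫ x, g x * conj (dualityMap p.toReal (u n x)) ∂μ := by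
      intro n
      rw [dualityFunctional_apply]
      refine integral_congr_ae ?_
      filter_upwards [(hu n p).coeFn_toLp] with x hx
      rw [hx]
    simp only [he]
    refine tendsto_integral_of_dominated_convergence
      (fun x => 2 ^ (p.toReal - 1) * (‖g x‖ * ‖dualityMap p.toReal (f x)‖)) (fun n => ?_)
      ((holder_dualityMap h1 hp f g).1.const_mul _) (fun n => ?_) ?_
    · exact (Lp.aestronglyMeasurable g).mul (RCLike.continuous_conj.measurable.comp
        ((continuous_dualityMap hr).measurable.comp (u n).measurable)).aestronglyMeasurable
    · refine Eventually.of_forall fun x => ?_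
      rw [norm_mul, RCLike.norm_conj, norm_dualityMap hr, norm_dualityMap hr, mul_left_comm,
        ← Real.mul_rpow zero_le_two (norm_nonneg _)]
      gcongr
      exact hb n x
    · refine Eventually.of_forall fun x => ?_
      exact tendsto_const_nhds.mul ((RCLike.continuous_conj.tendsto _).comp
        (((continuous_dualityMap hr).tendsto _).comp (hpt x)))
  have hE : Tendsto (fun n => dualityFunctional h1 hp (v n) (v n - Tp (v n) - g)) atTop (𝓝 0) := by
    have h2 : Tendsto (fun n => ‖v n‖ ^ (p.toReal - 1) * ‖v n - Tp (v n) - g‖) atTop (𝓝 0) := by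
      have h3 := (hlim.norm.rpow_const (p := p.toReal - 1) (Or.inr (by linarith))).mul
        ((hlim.sub ((Tp.continuous.tendsto f).comp hlim)).sub_const g).norm
      rwa [hg, sub_self, norm_zero, mul_zero] at h3
    exact squeeze_zero_norm (fun n => ContinuousLinearMap.le_of_opNorm_le _
      (norm_dualityFunctional_le h1 hp (v n)) _) h2
  have := hE.add hD
  rw [zero_add] at this
  exact this.congr fun n => by rw [map_sub _ _ g, sub_add_cancel]

/-- If `z` lies in the polar sector, then `z (1 - Tp)` is accretive on `L^p`, since
`Re ∫ z (f - Tp f) conj (F_p f)` is nonnegative; so it generates contractions. -/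
theorem norm_exp_neg_smul_one_sub_le (hT : IsSymmetricContraction T)
    (h1 : 1 < p) (hp : p ≠ ∞) (h : IsLpExtension T Tp) {z : ℂ}
    (hz : z ∈ closedSector (Real.arccos |1 - 2 / p.toReal|)) :
    ‖NormedSpace.exp (-(z • (1 - Tp)))‖ ≤ 1 := by
  have hr := one_lt_toReal h1 hp
  refine norm_exp_neg_le_one fun t f ht => ?_
  rcases eq_or_ne f 0 with rfl | hf
  · simp
  have hf0 : 0 < ‖f‖ := norm_pos_iff.2 hf
  set D := dualityFunctional h1 hp f with hD
  set w := D (f - Tp f) with hw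
  have hre : 0 ≤ (z * w).re := re_mul_nonneg_of_mem_closedSector (abs_nonneg _)
    (abs_one_sub_two_div_lt_one hr) hz (dualityFunctional_sub_apply_mem hT h1 hp h f)
  have hDv : D (f + (t : ℂ) • (z • (1 - Tp)) f) = ((‖f‖ ^ p.toReal : ℝ) : ℂ) + t * (z * w) := by
    rw [map_add, hD, dualityFunctional_self, ← hD, map_smul, smul_apply, map_smul]
    rfl
  have h2 : ‖f‖ ^ p.toReal ≤ ‖D (f + (t : ℂ) • (z • (1 - Tp)) f)‖ := by
    refine le_trans ?_ (Complex.re_le_norm _)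
    rw [hDv, Complex.add_re, Complex.ofReal_re, Complex.re_ofReal_mul]
    linarith [mul_nonneg ht hre]
  have h3 := h2.trans (ContinuousLinearMap.le_of_opNorm_le _ (norm_dualityFunctional_le h1 hp f) _)
  have h4 : ‖f‖ ^ p.toReal = ‖f‖ ^ (p.toReal - 1) * ‖f‖ := by
    rw [← Real.rpow_add_one hf0.ne', sub_add_cancel]
  rw [h4] at h3
  exact le_of_mul_le_mul_left h3 (by positivity)

theorem numericalRange_neg_generator_subset {T : ℝ≥0 → Lp ℂ 2 μ →L[ℂ] Lp ℂ 2 μ}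
    {Tp : ℝ≥0 → Lp ℂ p μ →L[ℂ] Lp ℂ p μ} (hT : ∀ t, IsSymmetricContraction (T t))
    (h1 : 1 < p) (hp : p ≠ ∞) (h : ∀ t, IsLpExtension (T t) (Tp t)) :
    numericalRange (-generator Tp) ⊆ closedSector (Real.arcsin |1 - 2 / p.toReal|) := by
  have h₀ : 0 ≤ Real.arcsin |1 - 2 / p.toReal| := Real.arcsin_nonneg.2 (abs_nonneg _)
  have h₁ := Real.arcsin_le_pi_div_two |1 - 2 / p.toReal|
  rintro z ⟨f, -, rfl⟩
  have hgen : InGeneratorGraph Tp (f : Lp ℂ p μ) (generator Tp f) := inGeneratorGraph_generator _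
  rw [← dualityFunctional_apply h1 hp]
  have hlim := ((dualityFunctional h1 hp (f : Lp ℂ p μ)).continuous.tendsto _).comp hgen.neg
  refine (isClosed_closedSector h₀ h₁).mem_of_tendsto hlim (Eventually.of_forall fun t => ?_)
  have := smul_mem_closedSector h₀ h₁ (dualityFunctional_sub_apply_mem (hT t) h1 hp (h t) f)
    (inv_nonneg.2 t.coe_nonneg)
  simp only [Function.comp]
  rwa [← smul_neg, neg_sub, map_smul, ← Complex.ofReal_inv, smul_eq_mul]

end NumericalRange

/-! ### The semigroup on `L²` -/

section SymmetricSemigroup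

variable {Ω : Type*} [MeasurableSpace Ω] {μ : Measure Ω}

/-- The operators of the semigroup are symmetric on `L²`, because the generator is. -/
theorem IsSymmetricLinftyContractive.isSymmetricContraction {A : Lp ℂ 2 μ →ₗ.[ℂ] Lp ℂ 2 μ}
    {T : ℝ≥0 → Lp ℂ 2 μ →L[ℂ] Lp ℂ 2 μ} (hT : IsSymmetricLinftyContractive A T) (t : ℝ≥0) :
    IsSymmetricContraction (T t) := by
  have hgraph : ∀ f g, InGeneratorGraph T f g → ∃ h : f ∈ A.domain, A ⟨f, h⟩ = -g := by
    intro f g hfg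
    have h1 : generator T ⟨f, hfg.mem_domain⟩ = g :=
      tendsto_nhds_unique (inGeneratorGraph_generator ⟨f, hfg.mem_domain⟩) hfg
    have h2 : (f, g) ∈ (generator T).graph :=
      (LinearPMap.mem_graph_iff _).2 ⟨⟨f, hfg.mem_domain⟩, rfl, h1⟩
    rw [hT.generator_eq, LinearPMap.mem_graph_iff] at h2
    obtain ⟨y, hy, hyg⟩ := h2
    obtain rfl : (y : Lp ℂ 2 μ) = f := hy
    refine ⟨y.2, ?_⟩
    rw [LinearPMap.neg_apply] at hyg
    rw [← show -A y = g from hyg, neg_neg]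
    rfl
  have hd : Dense ((generator T).domain : Set (Lp ℂ 2 μ)) := by
    rw [hT.generator_eq]
    exact hT.selfAdjoint.dense_domain
  have hc : ∀ t, ‖T t‖ ≤ 1 := hT.semigroup.norm_le_one_of_dissipative hd fun f g hfg => by
    obtain ⟨h, hA⟩ := hgraph f g hfg
    have := hT.nonneg ⟨f, h⟩
    rw [hA, inner_neg_right, Complex.neg_re] at this
    exact neg_nonneg.1 this
  have hformal : A.IsFormalAdjoint A := by
    have := LinearPMap.adjoint_isFormalAdjoint (T := A) hT.selfAdjoint.dense_domain
    rwa [LinearPMap.isSelfAdjoint_def.1 hT.selfAdjoint] at this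
  refine ⟨hT.semigroup.inner_apply_comm_of_symmetric hc hd (fun f f' g g' hf hg => ?_) t,
    hT.contractive t⟩
  obtain ⟨h, hA⟩ := hgraph f f' hf
  obtain ⟨h', hA'⟩ := hgraph g g' hg
  have := hformal ⟨f, h⟩ ⟨g, h'⟩
  rw [hA, hA', inner_neg_left, inner_neg_right] at this
  exact neg_injective this

end SymmetricSemigroup

theorem theorem1 {Ω : Type*} [MeasurableSpace Ω] (μ : Measure Ω)
    (p : ℝ≥0∞) [Fact (1 ≤ p)] (hp : 1 < p) (hp_top : p ≠ ∞)
    (A : Lp ℂ 2 μ →ₗ.[ℂ] Lp ℂ 2 μ) (T : ℝ≥0 → Lp ℂ 2 μ →L[ℂ] Lp ℂ 2 μ)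
    (hT : IsSymmetricLinftyContractive A T) :
    (∃! Tp : ℝ≥0 → Lp ℂ p μ →L[ℂ] Lp ℂ p μ, IsLpRealisation T Tp) ∧
    ∀ Tp : ℝ≥0 → Lp ℂ p μ →L[ℂ] Lp ℂ p μ, IsLpRealisation T Tp →
      IsC0Semigroup Tp ∧ (∀ t, ‖Tp t‖ ≤ 1) ∧
      numericalRange (-generator Tp) ⊆ closedSector (Real.arcsin |1 - 2 / p.toReal|) ∧
      ∃ S : ℂ → Lp ℂ p μ →L[ℂ] Lp ℂ p μ,
        IsAnalyticContractionSemigroup (Real.arccos |1 - 2 / p.toReal|) S ∧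
        ∀ t : ℝ≥0, S ((t : ℝ) : ℂ) = Tp t := by
  have hsymm := hT.isSymmetricContraction
  refine ⟨?_, fun Tp hTp => ?_⟩
  · choose Tp hTp using fun t => (hsymm t).exists_isLpExtension hp hp_top
    exact ⟨Tp, hTp, fun Tp' hTp' => funext fun t =>
      IsLpExtension.unique hp_top (hTp' t) (hTp t)⟩
  · have hext : ∀ t, IsLpExtension (T t) (Tp t) := hTp
    have hnorm : ∀ t, ‖Tp t‖ ≤ 1 := fun t =>
      IsLpExtension.norm_le_one (hsymm t) hp hp_top (hext t)
    have hC0 : IsC0Semigroup Tp := by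
      refine ⟨?_, fun s t => ?_, fun f =>
        continuous_of_isLpExtension hsymm hT.semigroup.continuous hp hp_top hext f⟩
      · have h0 := hext 0
        rw [hT.semigroup.zero] at h0
        exact h0.unique hp_top IsLpExtension.one
      · have hst := hext (s + t)
        rw [hT.semigroup.add] at hst
        exact hst.unique hp_top ((hext s).mul (hext t))
    refine ⟨hC0, hnorm, numericalRange_neg_generator_subset hsymm hp hp_top hext, ?_⟩
    exact hC0.exists_analytic_extension hnorm (Real.arccos_nonneg _)
      (Real.arccos_le_pi_div_two.2 (abs_nonneg _)) fun z hz t =>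
        norm_exp_neg_smul_one_sub_le (hsymm t) hp hp_top (hext t) hz
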